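/- Let $A$ be a C*-algebra, $\mathcal K$ the C*-algebra of compact operators on a separable infinite-dimensional Hilbert space, and let $\mathrm{Cu}(A)$ be the Cuntz semigroup of $A$: the set of classes $[a]$ of positive elements $a\in(A\otimes\mathcal K)_+$ modulo Cuntz equivalence, where $[a]\le[b]$ means that $r_n b r_n^*\to a$ in norm for some sequence $(r_n)$ in $A\otimes\mathcal K$, and where $[a]+[b]=[a\oplus b]$, with $a\oplus b\in M_2(A\otimes\mathcal K)\cong A\otimes\mathcal K$. For elements of an ordered set, write $s\ll t$ if for every increasing sequence $(t_n)$ having a supremum with $t\le\sup_n t_n$ there is $n_0$ with $s\le t_{n_0}$; a sequence $(s_n)$ is rapidly increasing if $s_n\ll s_{n+1}$ for all $n$. Then $S=\mathrm{Cu}(A)$ is an abelian monoid with a translation invariant partial order in which $0$ is the smallest element, and it satisfies: - **O1.** Every increasing sequence in $S$ has a supremum. - **O2.** Every $s\in S$ is the supremum of a rapidly increasing sequence. - **O3.** If $s_i\ll t_i$ for $i=1,2$, then $s_1+s_2\ll t_1+t_2$. - **O4.** If $(s_n)$ and $(t_n)$ are increasing sequences, then $\sup_n(s_n+t_n)=\sup_n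 s_n+\sup_n t_n$. - **O5.** If $s'\ll s\le t$, then there exists $r\in S$ such that $s'+r\le t\le s+r$. - **O6.** If $s\le r+t$, then for every $s'\ll s$ there exist $r',t'\in S$ such that $s'\le r'+t'$, $r'\le r$, $r'\le s$, $t'\le t$ and $t'\le s$. If, moreover, $A$ is separable, then $\mathrm{Cu}(A)$ has a countable dense subset, i.e. there is a countable set $D\subseteq \mathrm{Cu}(A)$ such that every element of $\mathrm{Cu}(A)$ is the supremum of a rapidly increasing sequence of elements of $D$. -/

import Mathlib

noncomputable section CuntzDefs

set_option linter.unusedSectionVars false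

namespace Cuntz

/-! ### Completion of a pre-C*-algebra -/

/-- The completion of a normed *-algebra satisfying the C*-identity. -/
def CStarCompletion (M : Type*) [NonUnitalNormedRing M] : Type _ := UniformSpace.Completion M

namespace CStarCompletion

section Basic

variable {M : Type*} [NonUnitalNormedRing M] [NormedSpace ℂ M]

instance : NormedAddCommGroup (CStarCompletion M) :=
  inferInstanceAs (NormedAddCommGroup (UniformSpace.Completion M))

instance : NormedSpace ℂ (CStarCompletion M) :=
  inferInstanceAs (NormedSpace ℂ (UniformSpace.Completion M))

instance : CompleteSpace (CStarCompletion M) :=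
  inferInstanceAs (CompleteSpace (UniformSpace.Completion M))

instance : IsTopologicalAddGroup (CStarCompletion M) :=
  SeminormedAddCommGroup.toIsTopologicalAddGroup

instance : ContinuousAdd (CStarCompletion M) :=
  (inferInstance : IsTopologicalAddGroup (CStarCompletion M)).toContinuousAdd

instance : ContinuousConstSMul ℂ (CStarCompletion M) :=
  IsBoundedSMul.continuousSMul.continuousConstSMul

/-- The canonical linear isometric embedding into the completion. -/
def of : M →ₗᵢ[ℂ] CStarCompletion M := UniformSpace.Completion.toComplₗᵢ

theorem isDenseInducing_of : IsDenseInducing (of : M → CStarCompletion M) :=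
  UniformSpace.Completion.isDenseInducing_coe

theorem denseRange_of : DenseRange (of : M → CStarCompletion M) :=
  isDenseInducing_of.dense

/-- The multiplication is the continuous extension of the multiplication of `M`. -/
instance : Mul (CStarCompletion M) where
  mul x y := (isDenseInducing_of.prodMap isDenseInducing_of).extend
    (fun p : M × M => (of (p.1 * p.2) : CStarCompletion M)) (x, y)

theorem of_mul (a b : M) : (of (a * b) : CStarCompletion M) = of a * of b :=
  ((isDenseInducing_of.prodMap isDenseInducing_of).extend_eq
    (f := fun p : M × M => (of (p.1 * p.2) : CStarCompletion M))
    (of.continuous.comp continuous_mul) (a, b)).symm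

instance : ContinuousMul (CStarCompletion M) where
  continuous_mul := by
    let m : M →+ M →+ CStarCompletion M :=
      (AddMonoidHom.mul : M →+ M →+ M).compr₂ (of : M →ₗᵢ[ℂ] _).toLinearMap.toAddMonoidHom
    have h : Continuous fun p : M × M => m p.1 p.2 := of.continuous.comp continuous_mul
    have di : IsDenseInducing ((of : M →ₗᵢ[ℂ] CStarCompletion M).toLinearMap.toAddMonoidHom) :=
      isDenseInducing_of
    exact di.extend_Z_bilin di h

@[elab_as_elim]
theorem induct {p : CStarCompletion M → Prop} (a : CStarCompletion M)
    (hc : IsClosed {a | p a}) (h : ∀ a : M, p (of a)) : p a :=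
  isClosed_property denseRange_of hc h a

theorem of_add (a b : M) : (of (a + b) : CStarCompletion M) = of a + of b := of.map_add a b

theorem of_zero : (of (0 : M) : CStarCompletion M) = 0 := of.map_zero

theorem of_smul (z : ℂ) (a : M) : (of (z • a) : CStarCompletion M) = z • of a := of.map_smul z a

theorem norm_of (a : M) : ‖(of a : CStarCompletion M)‖ = ‖a‖ := of.norm_map a

protected theorem zero_mul (a : CStarCompletion M) : 0 * a = 0 := by
  refine induct a (isClosed_eq (continuous_const.mul continuous_id) continuous_const) ?_; intro a
  rw [← of_zero, ← of_mul, zero_mul]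

protected theorem mul_zero (a : CStarCompletion M) : a * 0 = 0 := by
  refine induct a (isClosed_eq (continuous_id.mul continuous_const) continuous_const) ?_; intro a
  rw [← of_zero, ← of_mul, mul_zero]

protected theorem mul_add (a b c : CStarCompletion M) : a * (b + c) = a * b + a * c := by
  refine induct a (isClosed_eq (continuous_id.mul continuous_const) ((continuous_id.mul continuous_const).add (continuous_id.mul continuous_const))) ?_; intro a
  refine induct b (isClosed_eq (continuous_const.mul (continuous_id.add continuous_const)) ((continuous_const.mul continuous_id).add continuous_const)) ?_; intro b
  refine induct c (isClosed_eq (continuous_const.mul (continuous_const.add continuous_id)) (continuous_const.add (continuous_const.mul continuous_id))) ?_; intro c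
  rw [← of_add, ← of_mul, ← of_mul, ← of_mul, ← of_add, mul_add]

protected theorem add_mul (a b c : CStarCompletion M) : (a + b) * c = a * c + b * c := by
  refine induct a (isClosed_eq ((continuous_id.add continuous_const).mul continuous_const) ((continuous_id.mul continuous_const).add continuous_const)) ?_; intro a
  refine induct b (isClosed_eq ((continuous_const.add continuous_id).mul continuous_const) (continuous_const.add (continuous_id.mul continuous_const))) ?_; intro b
  refine induct c (isClosed_eq (continuous_const.mul continuous_id) ((continuous_const.mul continuous_id).add (continuous_const.mul continuous_id))) ?_; intro c
  rw [← of_add, ← of_mul, ← of_mul, ← of_mul, ← of_add, add_mul]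

protected theorem mul_assoc (a b c : CStarCompletion M) : a * b * c = a * (b * c) := by
  refine induct a (isClosed_eq ((continuous_id.mul continuous_const).mul continuous_const) (continuous_id.mul continuous_const)) ?_; intro a
  refine induct b (isClosed_eq ((continuous_const.mul continuous_id).mul continuous_const) (continuous_const.mul (continuous_id.mul continuous_const))) ?_; intro b
  refine induct c (isClosed_eq (continuous_const.mul continuous_id) (continuous_const.mul (continuous_const.mul continuous_id))) ?_; intro c
  rw [← of_mul, ← of_mul, ← of_mul, ← of_mul, mul_assoc]

protected theorem norm_mul_le (a b : CStarCompletion M) : ‖a * b‖ ≤ ‖a‖ * ‖b‖ := by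
  refine induct a (isClosed_le (continuous_id.mul continuous_const).norm (continuous_id.norm.mul continuous_const)) ?_; intro a
  refine induct b (isClosed_le (continuous_const.mul continuous_id).norm (continuous_const.mul continuous_id.norm)) ?_; intro b
  rw [← of_mul, norm_of, norm_of, norm_of]
  exact norm_mul_le a b

instance : NonUnitalNormedRing (CStarCompletion M) where
  __ := (inferInstance : NormedAddCommGroup (CStarCompletion M))
  zero_mul := CStarCompletion.zero_mul
  mul_zero := CStarCompletion.mul_zero
  left_distrib := CStarCompletion.mul_add
  right_distrib := CStarCompletion.add_mul
  mul_assoc := CStarCompletion.mul_assoc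
  norm_mul_le := CStarCompletion.norm_mul_le

protected theorem smul_mul [IsScalarTower ℂ M M] (z : ℂ) (a b : CStarCompletion M) :
    (z • a) * b = z • (a * b) := by
  refine induct a (isClosed_eq ((continuous_id.const_smul z).mul continuous_const) ((continuous_id.mul continuous_const).const_smul z)) ?_; intro a
  refine induct b (isClosed_eq (continuous_const.mul continuous_id) ((continuous_const.mul continuous_id).const_smul z)) ?_; intro b
  rw [← of_smul, ← of_mul, ← of_mul, ← of_smul, smul_mul_assoc]

protected theorem mul_smul [SMulCommClass ℂ M M] (z : ℂ) (a b : CStarCompletion M) :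
    a * (z • b) = z • (a * b) := by
  refine induct a (isClosed_eq (continuous_id.mul continuous_const) ((continuous_id.mul continuous_const).const_smul z)) ?_; intro a
  refine induct b (isClosed_eq (continuous_const.mul (continuous_id.const_smul z)) ((continuous_const.mul continuous_id).const_smul z)) ?_; intro b
  rw [← of_smul, ← of_mul, ← of_mul, ← of_smul, mul_smul_comm]

end Basic

section Star

variable {M : Type*} [NonUnitalNormedRing M] [StarRing M] [CStarRing M] [NormedSpace ℂ M]

/-- The involution is the continuous extension of the involution of `M`. -/
instance : Star (CStarCompletion M) where
  star := UniformSpace.Completion.map (star : M → M)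

theorem of_star (a : M) : (of (star a) : CStarCompletion M) = star (of a) :=
  (UniformSpace.Completion.map_coe (starNormedAddGroupHom : NormedAddGroupHom M M).uniformContinuous a).symm

theorem continuous_star_aux : Continuous (star : CStarCompletion M → CStarCompletion M) :=
  UniformSpace.Completion.continuous_map

theorem continuous_star_comp {X : Type*} [TopologicalSpace X] {f : X → CStarCompletion M}
    (hf : Continuous f) : Continuous fun x => star (f x) :=
  continuous_star_aux.comp hf

protected theorem star_star (a : CStarCompletion M) : star (star a) = a := by
  refine induct a (isClosed_eq (continuous_star_comp (continuous_star_comp continuous_id)) continuous_id) ?_; intro a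
  rw [← of_star, ← of_star, star_star]

protected theorem star_mul (a b : CStarCompletion M) : star (a * b) = star b * star a := by
  refine induct a (isClosed_eq (continuous_star_comp (continuous_id.mul continuous_const)) (continuous_const.mul (continuous_star_comp continuous_id))) ?_; intro a
  refine induct b (isClosed_eq (continuous_star_comp (continuous_const.mul continuous_id)) ((continuous_star_comp continuous_id).mul continuous_const)) ?_; intro b
  rw [← of_mul, ← of_star, ← of_star, ← of_star, ← of_mul, star_mul]

protected theorem star_add (a b : CStarCompletion M) : star (a + b) = star a + star b := by
  refine induct a (isClosed_eq (continuous_star_comp (continuous_id.add continuous_const)) ((continuous_star_comp continuous_id).add continuous_const)) ?_; intro a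
  refine induct b (isClosed_eq (continuous_star_comp (continuous_const.add continuous_id)) (continuous_const.add (continuous_star_comp continuous_id))) ?_; intro b
  rw [← of_add, ← of_star, ← of_star, ← of_star, ← of_add, star_add]

protected theorem star_smul [StarModule ℂ M] (z : ℂ) (a : CStarCompletion M) :
    star (z • a) = star z • star a := by
  refine induct a (isClosed_eq (continuous_star_comp (continuous_id.const_smul z)) ((continuous_star_comp continuous_id).const_smul (star z))) ?_; intro a
  rw [← of_smul, ← of_star, ← of_star, ← of_smul, star_smul]

protected theorem norm_mul_self_le (a : CStarCompletion M) : ‖a‖ * ‖a‖ ≤ ‖star a * a‖ := by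
  refine induct a (isClosed_le (continuous_id.norm.mul continuous_id.norm) ((continuous_star_comp continuous_id).mul continuous_id).norm) ?_; intro a
  rw [← of_star, ← of_mul, norm_of, norm_of]
  exact CStarRing.norm_mul_self_le a

/-- The completion of a pre-C*-algebra is a C*-algebra. -/
instance [IsScalarTower ℂ M M] [SMulCommClass ℂ M M] [StarModule ℂ M] :
    NonUnitalCStarAlgebra (CStarCompletion M) where
  __ := (inferInstance : NonUnitalNormedRing (CStarCompletion M))
  __ := (inferInstance : NormedSpace ℂ (CStarCompletion M))
  toCompleteSpace := inferInstance
  star_involutive := CStarCompletion.star_star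
  star_mul := CStarCompletion.star_mul
  star_add := CStarCompletion.star_add
  norm_mul_self_le := CStarCompletion.norm_mul_self_le
  smul_assoc := CStarCompletion.smul_mul
  smul_comm z a b := (CStarCompletion.mul_smul z a b).symm
  star_smul := CStarCompletion.star_smul

end Star

end CStarCompletion

/-! ### Finitely supported infinite matrices -/

section Spread

variable {A : Type*} {k l m n k' l' m' n' : Type*}

/-- Move the `(p, q)` entry of a matrix to position `(f p, g q)` and fill up with zeros. -/
def spread [Zero A] (f : m ↪ m') (g : n ↪ n') (x : m → n → A) : m' → n' → A :=
  Function.extend f (fun p => Function.extend g (x p) 0) 0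

section Zero

variable [Zero A] (f : m ↪ m') (g : n ↪ n')

theorem spread_apply (x : m → n → A) (p : m) (q : n) : spread f g x (f p) (g q) = x p q := by
  simp [spread, f.injective.extend_apply, g.injective.extend_apply]

theorem spread_of_left (x : m → n → A) {i : m'} (hi : i ∉ Set.range f) (j : n') :
    spread f g x i j = 0 := by
  rw [spread, Function.extend_apply' _ _ _ (by simpa using hi)]
  rfl

theorem spread_of_right (x : m → n → A) (i : m') {j : n'} (hj : j ∉ Set.range g) :
    spread f g x i j = 0 := by
  by_cases hi : i ∈ Set.range f
  · obtain ⟨p, rfl⟩ := hi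
    rw [spread, f.injective.extend_apply, Function.extend_apply' _ _ _ (by simpa using hj)]
    rfl
  · exact spread_of_left f g x hi j

theorem eq_spread {x : m → n → A} {y : m' → n' → A} (h : ∀ p q, y (f p) (g q) = x p q)
    (hl : ∀ i ∉ Set.range f, ∀ j, y i j = 0) (hr : ∀ i, ∀ j ∉ Set.range g, y i j = 0) :
    y = spread f g x := by
  ext i j
  by_cases hi : i ∈ Set.range f
  · by_cases hj : j ∈ Set.range g
    · obtain ⟨p, rfl⟩ := hi
      obtain ⟨q, rfl⟩ := hj
      rw [h, spread_apply]
    · rw [hr i j hj, spread_of_right f g x i hj]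
  · rw [hl i hi j, spread_of_left f g x hi]

theorem spread_spread (f' : m' ↪ k) (g' : n' ↪ l) (x : m → n → A) :
    spread f' g' (spread f g x) = spread (f.trans f') (g.trans g') x := by
  refine eq_spread _ _ (fun p q => ?_) (fun i hi j => ?_) (fun i j hj => ?_)
  · simp [spread_apply]
  · by_cases h : i ∈ Set.range f'
    · obtain ⟨i, rfl⟩ := h
      by_cases h : j ∈ Set.range g'
      · obtain ⟨j, rfl⟩ := h
        rw [spread_apply, spread_of_left]
        rintro ⟨p, rfl⟩
        exact hi ⟨p, rfl⟩
      · exact spread_of_right _ _ _ _ h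
    · exact spread_of_left _ _ _ h _
  · by_cases h : j ∈ Set.range g'
    · obtain ⟨j, rfl⟩ := h
      by_cases h : i ∈ Set.range f'
      · obtain ⟨i, rfl⟩ := h
        rw [spread_apply, spread_of_right]
        rintro ⟨p, rfl⟩
        exact hj ⟨p, rfl⟩
      · exact spread_of_left _ _ _ h _
    · exact spread_of_right _ _ _ _ h

theorem spread_refl (x : m → n → A) :
    spread (Function.Embedding.refl m) (Function.Embedding.refl n) x = x :=
  (eq_spread _ _ (fun _ _ => rfl) (fun i hi => (hi ⟨i, rfl⟩).elim)
    (fun _ j hj => (hj ⟨j, rfl⟩).elim)).symm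

end Zero

theorem spread_star [AddMonoid A] [StarAddMonoid A] (f : m ↪ m') (g : n ↪ n') (x : m → n → A) :
    (fun j i => star (spread f g x i j)) = spread g f (fun q p => star (x p q)) := by
  refine eq_spread _ _ (fun p q => ?_) (fun i hi j => ?_) (fun i j hj => ?_)
  · rw [spread_apply]
  · rw [spread_of_right _ _ _ _ hi, star_zero]
  · rw [spread_of_left _ _ _ hj, star_zero]

theorem spread_add [AddMonoid A] (f : m ↪ m') (g : n ↪ n') (x y : m → n → A) :
    spread f g (x + y) = spread f g x + spread f g y := by
  refine (eq_spread _ _ (fun p q => ?_) (fun i hi j => ?_) (fun i j hj => ?_)).symm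
  · simp [spread_apply]
  · simp [spread_of_left _ _ _ hi]
  · simp [spread_of_right _ _ _ _ hj]

theorem spread_smul [AddMonoid A] {R : Type*} [SMulZeroClass R A] (f : m ↪ m') (g : n ↪ n')
    (c : R) (x : m → n → A) : spread f g (c • x) = c • spread f g x := by
  refine (eq_spread _ _ (fun p q => ?_) (fun i hi j => ?_) (fun i j hj => ?_)).symm
  · simp [spread_apply]
  · simp [spread_of_left _ _ _ hi]
  · simp [spread_of_right _ _ _ _ hj]

theorem spread_mul [NonUnitalNonAssocSemiring A] (f : m ↪ m') (g : n ↪ n') (h : l ↪ l')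
    (x : m → n → A) (y : n → l → A) :
    (fun i j => ∑ᶠ r, spread f g x i r * spread g h y r j) =
      spread f h (fun p q => ∑ᶠ r, x p r * y r q) := by
  refine eq_spread _ _ (fun p q => ?_) (fun i hi j => ?_) (fun i j hj => ?_)
  · have e := finsum_mem_range (f := fun r => spread f g x (f p) r * spread g h y r (h q))
      g.injective
    simp only [spread_apply] at e
    rw [← e]
    refine finsum_congr fun r => ?_
    by_cases hr : r ∈ Set.range g
    · simp only [hr, finsum_true]
    · simp only [hr, finsum_false, spread_of_right _ _ _ _ hr, zero_mul]
  · simp [spread_of_left _ _ _ hi]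
  · simp [spread_of_right _ _ _ _ hj]

theorem spread_mul_of_disjoint [NonUnitalNonAssocSemiring A] (f : m ↪ m') {g : n ↪ n'}
    {g' : k ↪ n'} (h : l ↪ l') (hg : Disjoint (Set.range g) (Set.range g'))
    (x : m → n → A) (y : k → l → A) (i : m') (j : l') :
    ∑ᶠ r, spread f g x i r * spread g' h y r j = 0 := by
  refine finsum_eq_zero_of_forall_eq_zero fun r => ?_
  by_cases hr : r ∈ Set.range g
  · rw [spread_of_left _ _ _ (Set.disjoint_left.1 hg hr), mul_zero]
  · rw [spread_of_right _ _ _ _ hr, zero_mul]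

end Spread

section Pad

variable {A : Type*} [NonUnitalCStarAlgebra A] [PartialOrder A] [StarOrderedRing A]
  {m n : Type*} [Fintype m] [Fintype n]

/-- The inclusion of matrix algebras induced by an injection of index sets. -/
def padHom (f : m ↪ n) : CStarMatrix m m A →⋆ₙₐ[ℂ] CStarMatrix n n A where
  toFun x := CStarMatrix.ofMatrix (spread f f x)
  map_smul' c x := spread_smul f f c x
  map_zero' := by
    have := spread_smul (A := A) f f (0 : ℂ) 0
    rw [zero_smul, zero_smul] at this
    exact this
  map_add' x y := spread_add f f x y
  map_mul' x y := by
    have := spread_mul f f f x y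
    simp only [finsum_eq_sum_of_fintype] at this
    ext i j
    rw [CStarMatrix.mul_apply]
    refine Eq.trans ?_ (congrFun (congrFun this i) j).symm
    change spread f f _ i j = _
    congr 1
  map_star' x := (spread_star f f x).symm

theorem padHom_injective (f : m ↪ n) : Function.Injective (padHom (A := A) f) := by
  intro x y h
  ext p q
  have := congrFun (congrFun h (f p)) (f q)
  exact (spread_apply f f x p q).symm.trans (this.trans (spread_apply f f y p q))

theorem norm_padHom (f : m ↪ n) (x : CStarMatrix m m A) : ‖padHom f x‖ = ‖x‖ :=
  NonUnitalStarAlgHom.norm_map _ (padHom_injective f) x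

end Pad


/-- The space `M_∞(A)` of infinite matrices over `A` with finitely many non-zero entries, as a
subspace of all infinite matrices. -/
def finMatSubmodule (A : Type*) [AddCommMonoid A] [Module ℂ A] : Submodule ℂ (ℕ → ℕ → A) where
  carrier := {x | ∃ n, ∀ i j, n ≤ i ∨ n ≤ j → x i j = 0}
  zero_mem' := ⟨0, fun _ _ _ => rfl⟩
  add_mem' := by
    rintro x y ⟨n, hn⟩ ⟨m, hm⟩
    refine ⟨max n m, fun i j h => ?_⟩
    rw [Pi.add_apply, Pi.add_apply, hn i j (by omega), hm i j (by omega), add_zero]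
  smul_mem' := by
    rintro c x ⟨n, hn⟩
    refine ⟨n, fun i j h => ?_⟩
    rw [Pi.smul_apply, Pi.smul_apply, hn i j h, smul_zero]

/-- The pre-C*-algebra `M_∞(A) = ⋃ M_n(A)` of infinite matrices over `A` with finitely many
non-zero entries. -/
def FinMat (A : Type*) [AddCommMonoid A] [Module ℂ A] : Type _ := finMatSubmodule A

namespace FinMat

variable {A : Type*} [NonUnitalCStarAlgebra A]

instance : AddCommGroup (FinMat A) := inferInstanceAs (AddCommGroup (finMatSubmodule A))

instance : Module ℂ (FinMat A) := inferInstanceAs (Module ℂ (finMatSubmodule A))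

/-- The entries of a finitely supported matrix. -/
def entry (x : FinMat A) : ℕ → ℕ → A := x.1

instance : CoeFun (FinMat A) (fun _ => ℕ → ℕ → A) := ⟨entry⟩

@[ext]
theorem ext {x y : FinMat A} (h : ∀ i j, x i j = y i j) : x = y :=
  Subtype.ext (funext fun i => funext fun j => h i j)

theorem add_apply (x y : FinMat A) (i j : ℕ) : (x + y) i j = x i j + y i j := rfl

theorem zero_apply (i j : ℕ) : (0 : FinMat A) i j = 0 := rfl

theorem smul_apply (c : ℂ) (x : FinMat A) (i j : ℕ) : (c • x) i j = c • x i j := rfl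

/-- `x` is supported in the upper left `n × n` corner. -/
def Below (n : ℕ) (x : FinMat A) : Prop := ∀ i j, n ≤ i ∨ n ≤ j → x i j = 0

theorem exists_below (x : FinMat A) : ∃ n, Below n x := x.2

theorem Below.mono {n m : ℕ} {x : FinMat A} (h : Below n x) (hnm : n ≤ m) : Below m x :=
  fun i j hij => h i j (by omega)

theorem Below.add {n : ℕ} {x y : FinMat A} (hx : Below n x) (hy : Below n y) :
    Below n (x + y) := fun i j h => by rw [add_apply, hx i j h, hy i j h, add_zero]

theorem Below.smul {n : ℕ} {x : FinMat A} (c : ℂ) (hx : Below n x) :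
    Below n (c • x) := fun i j h => by rw [smul_apply, hx i j h, smul_zero]

/-- Matrix multiplication. -/
instance : Mul (FinMat A) where
  mul x y := ⟨fun i j => ∑ᶠ k, x i k * y k j, by
    obtain ⟨n, hn⟩ := exists_below x
    obtain ⟨m, hm⟩ := exists_below y
    refine ⟨max n m, fun i j h => finsum_eq_zero_of_forall_eq_zero fun k => ?_⟩
    rcases h with h | h
    · rw [hn i k (by omega), zero_mul]
    · rw [hm k j (by omega), mul_zero]⟩

theorem mul_apply (x y : FinMat A) (i j : ℕ) : (x * y) i j = ∑ᶠ k, x i k * y k j := rfl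

theorem Below.mul {n : ℕ} {x y : FinMat A} (hx : Below n x) (hy : Below n y) :
    Below n (x * y) := by
  refine fun i j h => finsum_eq_zero_of_forall_eq_zero fun k => ?_
  rcases h with h | h
  · rw [hx i k (by omega), zero_mul]
  · rw [hy k j (by omega), mul_zero]

/-- Conjugate transpose. -/
instance : Star (FinMat A) where
  star x := ⟨fun i j => star (x j i), by
    obtain ⟨n, hn⟩ := exists_below x
    exact ⟨n, fun i j h => by simp only [hn j i (by omega), star_zero]⟩⟩

theorem star_apply (x : FinMat A) (i j : ℕ) : (star x) i j = star (x j i) := rfl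

theorem Below.star {n : ℕ} {x : FinMat A} (hx : Below n x) : Below n (star x) :=
  fun i j h => by rw [star_apply, hx j i (by omega), star_zero]

/-- The upper left `n × n` corner. -/
def corner (n : ℕ) : FinMat A →ₗ[ℂ] CStarMatrix (Fin n) (Fin n) A where
  toFun x := CStarMatrix.ofMatrix fun i j => x i j
  map_add' _ _ := rfl
  map_smul' _ _ := rfl

theorem corner_apply (n : ℕ) (x : FinMat A) (i j : Fin n) : corner n x i j = x i j := rfl

theorem corner_mul {n : ℕ} {x : FinMat A} (hx : Below n x) (y : FinMat A) :
    corner n (x * y) = corner n x * corner n y := by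
  ext i j
  rw [CStarMatrix.mul_apply, corner_apply, mul_apply,
    finsum_eq_sum_of_support_subset (s := Finset.range n), Finset.sum_range]
  · rfl
  · intro k hk
    by_contra h
    refine hk ?_
    simp only [hx i k (Or.inr (by simpa using h)), zero_mul]

theorem corner_star (n : ℕ) (x : FinMat A) : corner n (star x) = star (corner n x) := rfl

theorem eq_of_corner {n : ℕ} {x y : FinMat A} (hx : Below n x) (hy : Below n y)
    (h : corner n x = corner n y) : x = y := by
  ext i j
  by_cases hij : n ≤ i ∨ n ≤ j
  · rw [hx i j hij, hy i j hij]
  · exact congrFun (congrFun h ⟨i, by omega⟩) ⟨j, by omega⟩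

theorem exists_below₂ (x y : FinMat A) : ∃ n, Below n x ∧ Below n y := by
  obtain ⟨n, hn⟩ := exists_below x
  obtain ⟨m, hm⟩ := exists_below y
  exact ⟨max n m, hn.mono (by omega), hm.mono (by omega)⟩

theorem exists_below₃ (x y z : FinMat A) : ∃ n, Below n x ∧ Below n y ∧ Below n z := by
  obtain ⟨n, hn, hn'⟩ := exists_below₂ x y
  obtain ⟨m, hm⟩ := exists_below z
  exact ⟨max n m, hn.mono (by omega), hn'.mono (by omega), hm.mono (by omega)⟩

instance : NonUnitalRing (FinMat A) where
  left_distrib x y z := by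
    obtain ⟨n, hx, hy, hz⟩ := exists_below₃ x y z
    refine eq_of_corner (hx.mul (hy.add hz)) ((hx.mul hy).add (hx.mul hz)) ?_
    rw [map_add, corner_mul hx, corner_mul hx, corner_mul hx, map_add, mul_add]
  right_distrib x y z := by
    obtain ⟨n, hx, hy, hz⟩ := exists_below₃ x y z
    refine eq_of_corner ((hx.add hy).mul hz) ((hx.mul hz).add (hy.mul hz)) ?_
    rw [map_add, corner_mul (hx.add hy), corner_mul hx, corner_mul hy, map_add, add_mul]
  zero_mul x := by ext i j; simp [mul_apply, zero_apply]
  mul_zero x := by ext i j; simp [mul_apply, zero_apply]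
  mul_assoc x y z := by
    obtain ⟨n, hx, hy, hz⟩ := exists_below₃ x y z
    refine eq_of_corner ((hx.mul hy).mul hz) (hx.mul (hy.mul hz)) ?_
    rw [corner_mul (hx.mul hy), corner_mul hx, corner_mul hx, corner_mul hy, mul_assoc]

instance : StarRing (FinMat A) where
  star_involutive x := by ext i j; simp [star_apply]
  star_add x y := by ext i j; simp [star_apply, add_apply]
  star_mul x y := by
    obtain ⟨n, hx, hy⟩ := exists_below₂ x y
    refine eq_of_corner (hx.mul hy).star (hy.star.mul hx.star) ?_
    rw [corner_star, corner_mul hx, corner_mul hy.star, corner_star, corner_star, star_mul]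

instance : StarModule ℂ (FinMat A) where
  star_smul c x := by ext i j; simp [star_apply, smul_apply]

instance : IsScalarTower ℂ (FinMat A) (FinMat A) where
  smul_assoc c x y := by
    ext i j
    simp only [smul_eq_mul, mul_apply, smul_apply, smul_mul_assoc, smul_finsum]

instance : SMulCommClass ℂ (FinMat A) (FinMat A) where
  smul_comm c x y := by
    ext i j
    simp only [smul_eq_mul, mul_apply, smul_apply, mul_smul_comm, smul_finsum]

section Norm

variable [PartialOrder A] [StarOrderedRing A]

/-- The C*-norm of `M_∞(A)`: the norm of `x` as an element of the C*-algebra `M_n(A)`, for `n` large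
enough (see `norm_eq`). -/
instance : Norm (FinMat A) where
  norm x := ‖corner (Classical.choose (exists_below x)) x‖

theorem corner_eq_padHom {n m : ℕ} (hnm : n ≤ m) {x : FinMat A} (hx : Below n x) :
    corner m x = padHom (Fin.castLEEmb hnm) (corner n x) := by
  refine eq_spread _ _ (fun _ _ => rfl) (fun i hi j => hx i j (Or.inl ?_))
    (fun i j hj => hx i j (Or.inr ?_))
  · by_contra h
    exact hi ⟨⟨i, by omega⟩, rfl⟩
  · by_contra h
    exact hj ⟨⟨j, by omega⟩, rfl⟩

theorem norm_corner {n m : ℕ} (hnm : n ≤ m) {x : FinMat A} (hx : Below n x) :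
    ‖corner m x‖ = ‖corner n x‖ := by
  rw [corner_eq_padHom hnm hx, norm_padHom]

theorem norm_eq {n : ℕ} {x : FinMat A} (hx : Below n x) : ‖x‖ = ‖corner n x‖ := by
  have h := Classical.choose_spec (exists_below x)
  change ‖corner (Classical.choose (exists_below x)) x‖ = _
  rcases le_total n (Classical.choose (exists_below x)) with h' | h'
  · exact norm_corner h' hx
  · exact (norm_corner h' h).symm

theorem normedSpaceCore : NormedSpace.Core ℂ (FinMat A) where
  norm_nonneg x := norm_nonneg (corner _ x)
  norm_smul c x := by
    obtain ⟨n, hx⟩ := exists_below x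
    rw [norm_eq (hx.smul c), norm_eq hx, map_smul, norm_smul]
  norm_triangle x y := by
    obtain ⟨n, hx, hy⟩ := exists_below₂ x y
    rw [norm_eq (hx.add hy), norm_eq hx, norm_eq hy, map_add]
    exact norm_add_le _ _
  norm_eq_zero_iff x := by
    obtain ⟨n, hx⟩ := exists_below x
    rw [norm_eq hx, norm_eq_zero]
    refine ⟨fun h => eq_of_corner hx (fun _ _ _ => rfl) (by rw [h, map_zero]), ?_⟩
    rintro rfl
    exact map_zero _

instance : NormedAddCommGroup (FinMat A) := NormedAddCommGroup.ofCore normedSpaceCore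

instance : NormedSpace ℂ (FinMat A) := NormedSpace.ofCore normedSpaceCore

instance : NonUnitalNormedRing (FinMat A) where
  __ := (inferInstance : NormedAddCommGroup (FinMat A))
  __ := (inferInstance : NonUnitalRing (FinMat A))
  norm_mul_le x y := by
    obtain ⟨n, hx, hy⟩ := exists_below₂ x y
    rw [norm_eq (hx.mul hy), norm_eq hx, norm_eq hy, corner_mul hx]
    exact norm_mul_le _ _

instance : CStarRing (FinMat A) where
  norm_mul_self_le x := by
    obtain ⟨n, hx⟩ := exists_below x
    rw [norm_eq (hx.star.mul hx), norm_eq hx, corner_mul hx.star, corner_star]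
    exact CStarRing.norm_mul_self_le _

end Norm

/-- Move the `(p, q)` entry of a finitely supported matrix to position `(f p, g q)`. -/
def move (f g : ℕ ↪ ℕ) : FinMat A →ₗ[ℂ] FinMat A where
  toFun x := ⟨spread f g x, by
    obtain ⟨n, hn⟩ := exists_below x
    obtain ⟨N, hN⟩ := ((Set.finite_Iio n).image f |>.union ((Set.finite_Iio n).image g)).bddAbove
    refine ⟨N + 1, fun i j h => ?_⟩
    by_cases hi : i ∈ Set.range f
    · by_cases hj : j ∈ Set.range g
      · obtain ⟨p, rfl⟩ := hi
        obtain ⟨q, rfl⟩ := hj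
        rw [spread_apply]
        refine hn p q ?_
        by_contra! hpq
        have h1 := hN (Or.inl ⟨p, hpq.1, rfl⟩)
        have h2 := hN (Or.inr ⟨q, hpq.2, rfl⟩)
        omega
      · exact spread_of_right _ _ _ _ hj
    · exact spread_of_left _ _ _ hi _⟩
  map_add' x y := Subtype.ext (spread_add f g x.entry y.entry)
  map_smul' c x := Subtype.ext (spread_smul f g c x.entry)

theorem move_mul_move (f g h : ℕ ↪ ℕ) (x y : FinMat A) :
    move f g x * move g h y = move f h (x * y) :=
  Subtype.ext (spread_mul f g h x.entry y.entry)

theorem move_mul_move_of_disjoint (f : ℕ ↪ ℕ) {g g' : ℕ ↪ ℕ} (h : ℕ ↪ ℕ)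
    (hg : Disjoint (Set.range g) (Set.range g')) (x y : FinMat A) :
    move f g x * move g' h y = 0 :=
  ext fun i j => spread_mul_of_disjoint f h hg x.entry y.entry i j

theorem star_move (f g : ℕ ↪ ℕ) (x : FinMat A) : star (move f g x) = move g f (star x) :=
  Subtype.ext (spread_star f g x.entry)

theorem move_move (f g f' g' : ℕ ↪ ℕ) (x : FinMat A) :
    move f' g' (move f g x) = move (f.trans f') (g.trans g') x :=
  Subtype.ext (spread_spread f g f' g' x.entry)

theorem move_refl (x : FinMat A) :
    move (Function.Embedding.refl ℕ) (Function.Embedding.refl ℕ) x = x :=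
  Subtype.ext (spread_refl x.entry)

variable [PartialOrder A] [StarOrderedRing A]

theorem norm_move_self (f : ℕ ↪ ℕ) (x : FinMat A) : ‖move f f x‖ = ‖x‖ := by
  obtain ⟨n, hx⟩ := exists_below x
  obtain ⟨m, hm⟩ := exists_below (move f f x)
  obtain ⟨N, hN⟩ := ((Set.finite_Iio n).image f).bddAbove
  have hf : ∀ i : Fin n, f i < max m (N + 1) := fun i => by
    have := hN ⟨i, i.2, rfl⟩
    omega
  let e : Fin n ↪ Fin (max m (N + 1)) :=
    ⟨fun i => ⟨f i, hf i⟩, fun i j h => Fin.ext (f.injective (Fin.ext_iff.1 h))⟩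
  rw [norm_eq (hm.mono (le_max_left m (N + 1))), norm_eq hx, ← norm_padHom e]
  congr 1
  refine eq_spread _ _ (fun p q => spread_apply f f x.entry p q) (fun i hi j => ?_) (fun i j hj => ?_)
  · by_cases h : (i : ℕ) ∈ Set.range f
    · by_cases h' : (j : ℕ) ∈ Set.range f
      · obtain ⟨p, hp⟩ := h
        obtain ⟨q, hq⟩ := h'
        have : n ≤ p := by
          by_contra! hlt
          exact hi ⟨⟨p, hlt⟩, Fin.ext hp⟩
        change spread f f x.entry i j = 0
        rw [← hp, ← hq, spread_apply]
        exact hx p q (Or.inl this)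
      · exact spread_of_right _ _ _ _ h'
    · exact spread_of_left _ _ _ h _
  · by_cases h : (i : ℕ) ∈ Set.range f
    · by_cases h' : (j : ℕ) ∈ Set.range f
      · obtain ⟨p, hp⟩ := h
        obtain ⟨q, hq⟩ := h'
        have : n ≤ q := by
          by_contra! hlt
          exact hj ⟨⟨q, hlt⟩, Fin.ext hq⟩
        change spread f f x.entry i j = 0
        rw [← hp, ← hq, spread_apply]
        exact hx p q (Or.inr this)
      · exact spread_of_right _ _ _ _ h'
    · exact spread_of_left _ _ _ h _

theorem norm_move (f g : ℕ ↪ ℕ) (x : FinMat A) : ‖move f g x‖ = ‖x‖ := by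
  have h1 := CStarRing.norm_self_mul_star (x := move f g x)
  have h2 := CStarRing.norm_self_mul_star (x := x)
  rw [star_move, move_mul_move, norm_move_self, h2] at h1
  exact (mul_self_inj (norm_nonneg _) (norm_nonneg _)).1 h1.symm

end FinMat

/-! ### The stabilization `A ⊗ K` -/

section Stab

variable (A : Type*) [NonUnitalCStarAlgebra A] [PartialOrder A] [StarOrderedRing A]

/-- The stabilization `A ⊗ K` of a C*-algebra `A`, with `K` the algebra of compact operators on
`ℓ²(ℕ)`: the completion of `M_∞(A) = ⋃ M_n(A)` in its (unique) C*-norm. -/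
def Stab : Type _ := CStarCompletion (FinMat A)

instance : NonUnitalCStarAlgebra (Stab A) :=
  inferInstanceAs (NonUnitalCStarAlgebra (CStarCompletion (FinMat A)))

instance : PartialOrder (Stab A) := CStarAlgebra.spectralOrder (Stab A)

instance : StarOrderedRing (Stab A) := CStarAlgebra.spectralOrderedRing (Stab A)

end Stab

namespace Stab

variable {A : Type*} [NonUnitalCStarAlgebra A] [PartialOrder A] [StarOrderedRing A]

/-- The inclusion of `M_∞(A)` into `A ⊗ K`. -/
def incl : FinMat A →ₗᵢ[ℂ] Stab A := CStarCompletion.of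

theorem denseRange_incl : DenseRange (incl : FinMat A → Stab A) := CStarCompletion.denseRange_of

theorem incl_mul (x y : FinMat A) : incl (x * y) = incl x * incl y := CStarCompletion.of_mul x y

theorem incl_star (x : FinMat A) : incl (star x) = star (incl x) := CStarCompletion.of_star x

@[elab_as_elim]
theorem induct {p : Stab A → Prop} (a : Stab A) (hc : IsClosed {a | p a})
    (h : ∀ a : FinMat A, p (incl a)) : p a :=
  isClosed_property denseRange_incl hc h a

/-- The map on `A ⊗ K` that moves the `(p, q)` matrix entry to position `(f p, g q)`, that is,
`x ↦ v x w*` for the isometries `v e_p = e_{f p}` and `w e_q = e_{g q}`. -/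
def move (f g : ℕ ↪ ℕ) : Stab A →L[ℂ] Stab A :=
  (incl.toLinearMap ∘ₗ FinMat.move f g).extendOfNorm incl.toLinearMap

theorem move_incl (f g : ℕ ↪ ℕ) (x : FinMat A) : move f g (incl x) = incl (FinMat.move f g x) :=
  LinearMap.extendOfNorm_eq (f := incl.toLinearMap ∘ₗ FinMat.move f g) (e := incl.toLinearMap)
    denseRange_incl
    ⟨1, fun x => le_of_eq ((incl.norm_map _).trans ((FinMat.norm_move f g x).trans
      ((incl.norm_map x).symm.trans (one_mul _).symm)))⟩ x

theorem norm_move (f g : ℕ ↪ ℕ) (x : Stab A) : ‖move f g x‖ = ‖x‖ := by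
  refine induct x (isClosed_eq (move f g).continuous.norm continuous_norm) ?_
  intro x
  rw [move_incl, incl.norm_map, incl.norm_map, FinMat.norm_move]

theorem move_mul_move (f g h : ℕ ↪ ℕ) (x y : Stab A) :
    move f g x * move g h y = move f h (x * y) := by
  refine induct x (isClosed_eq ((move f g).continuous.mul continuous_const)
    ((move f h).continuous.comp (continuous_id.mul continuous_const))) ?_
  intro x
  refine induct y (isClosed_eq (continuous_const.mul (move g h).continuous)
    ((move f h).continuous.comp (continuous_const.mul continuous_id))) ?_
  intro y
  rw [move_incl, move_incl, ← incl_mul, ← incl_mul, move_incl, FinMat.move_mul_move]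

theorem move_mul_move_of_disjoint (f : ℕ ↪ ℕ) {g g' : ℕ ↪ ℕ} (h : ℕ ↪ ℕ)
    (hg : Disjoint (Set.range g) (Set.range g')) (x y : Stab A) :
    move f g x * move g' h y = 0 := by
  refine induct x (isClosed_eq ((move f g).continuous.mul continuous_const)
    continuous_const) ?_
  intro x
  refine induct y (isClosed_eq (continuous_const.mul (move g' h).continuous)
    continuous_const) ?_
  intro y
  rw [move_incl, move_incl, ← incl_mul, FinMat.move_mul_move_of_disjoint f h hg, map_zero]

theorem star_move (f g : ℕ ↪ ℕ) (x : Stab A) : star (move f g x) = move g f (star x) := by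
  refine induct x (isClosed_eq (continuous_star.comp (move f g).continuous)
    ((move g f).continuous.comp continuous_star)) ?_
  intro x
  rw [move_incl, ← incl_star, ← incl_star, move_incl, FinMat.star_move]

theorem move_move (f g f' g' : ℕ ↪ ℕ) (x : Stab A) :
    move f' g' (move f g x) = move (f.trans f') (g.trans g') x := by
  refine induct x (isClosed_eq ((move f' g').continuous.comp (move f g).continuous)
    (move _ _).continuous) ?_
  intro x
  rw [move_incl, move_incl, move_incl, FinMat.move_move]

theorem move_refl (x : Stab A) :
    move (Function.Embedding.refl ℕ) (Function.Embedding.refl ℕ) x = x := by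
  refine induct x (isClosed_eq (move _ _).continuous continuous_id) ?_
  intro x
  rw [move_incl, FinMat.move_refl]

theorem move_nonneg (f : ℕ ↪ ℕ) {a : Stab A} (ha : 0 ≤ a) : 0 ≤ move f f a := by
  obtain ⟨b, rfl⟩ := CStarAlgebra.nonneg_iff_eq_star_mul_self.1 ha
  rw [← move_mul_move f f f, ← star_move]
  exact star_mul_self_nonneg _

end Stab

/-! ### Cuntz comparison -/

section Comparison

variable {B : Type*} [NonUnitalCStarAlgebra B]

/-- Cuntz subequivalence in a C*-algebra: `a` is a norm limit of elements `r * b * r*`. -/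
def CuntzLE (a b : B) : Prop := ∀ ε > 0, ∃ r : B, ‖r * b * star r - a‖ < ε

theorem CuntzLE.refl (a : B) : CuntzLE a a := by
  let _ := CStarAlgebra.spectralOrder B
  have _ := CStarAlgebra.spectralOrderedRing B
  intro ε hε
  have hu := CStarAlgebra.increasingApproximateUnit B
  have h1 : ∀ᶠ e in CStarAlgebra.approximateUnit B, ‖e * a - a‖ < ε / 2 := by
    have := (hu.tendsto_mul_right a).eventually (Metric.ball_mem_nhds a (half_pos hε))
    simpa [dist_eq_norm] using this
  have h2 : ∀ᶠ e in CStarAlgebra.approximateUnit B, ‖a * e - a‖ < ε / 2 := by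
    have := (hu.tendsto_mul_left a).eventually (Metric.ball_mem_nhds a (half_pos hε))
    simpa [dist_eq_norm] using this
  obtain ⟨e, h1, h2, h3, h4⟩ :=
    (h1.and (h2.and (hu.eventually_norm.and hu.eventually_star_eq))).exists
  refine ⟨e, ?_⟩
  have h5 : e * a * star e - a = (e * a - a) * e + (a * e - a) := by
    rw [h4]
    noncomm_ring
  calc ‖e * a * star e - a‖ ≤ ‖(e * a - a) * e‖ + ‖a * e - a‖ := h5 ▸ norm_add_le _ _
    _ ≤ ‖e * a - a‖ * ‖e‖ + ‖a * e - a‖ := by gcongr; exact norm_mul_le _ _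
    _ ≤ ‖e * a - a‖ * 1 + ‖a * e - a‖ := by gcongr
    _ < ε := by linarith

theorem CuntzLE.trans {a b c : B} (hab : CuntzLE a b) (hbc : CuntzLE b c) : CuntzLE a c := by
  intro ε hε
  obtain ⟨r, hr⟩ := hab (ε / 2) (half_pos hε)
  obtain ⟨s, hs⟩ := hbc (ε / (2 * (‖r‖ ^ 2 + 1))) (by positivity)
  refine ⟨r * s, ?_⟩
  have h5 : r * s * c * star (r * s) - a =
      r * (s * c * star s - b) * star r + (r * b * star r - a) := by
    rw [star_mul]
    noncomm_ring
  have h6 : ‖r * (s * c * star s - b) * star r‖ ≤ ‖r‖ ^ 2 * ‖s * c * star s - b‖ := by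
    calc _ ≤ ‖r‖ * ‖s * c * star s - b‖ * ‖star r‖ :=
          (norm_mul_le _ _).trans (by gcongr; exact norm_mul_le _ _)
      _ = _ := by rw [norm_star]; ring
  have h7 : ‖r‖ ^ 2 * ‖s * c * star s - b‖ ≤ ε / 2 := by
    rw [lt_div_iff₀ (by positivity)] at hs
    nlinarith [norm_nonneg (s * c * star s - b)]
  rw [h5]
  exact (norm_add_le _ _).trans_lt (by linarith)

theorem CuntzLE.zero (b : B) : CuntzLE 0 b := fun ε hε => ⟨0, by simpa using hε⟩

end Comparison

section Sum

variable {A : Type*} [NonUnitalCStarAlgebra A] [PartialOrder A] [StarOrderedRing A]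

theorem CuntzLE.sum_move {ι : Type*} [Fintype ι] (f g : ι → ℕ ↪ ℕ)
    (hg : Pairwise fun i j => Disjoint (Set.range (g i)) (Set.range (g j)))
    {a b : ι → Stab A} (h : ∀ i, CuntzLE (a i) (b i)) :
    CuntzLE (∑ i, Stab.move (f i) (f i) (a i)) (∑ i, Stab.move (g i) (g i) (b i)) := by
  classical
  intro ε hε
  choose x hx using fun i => h i (ε / (Fintype.card ι + 1)) (by positivity)
  refine ⟨∑ i, Stab.move (f i) (g i) (x i), ?_⟩
  have h1 : (∑ i, Stab.move (f i) (g i) (x i)) * (∑ i, Stab.move (g i) (g i) (b i)) =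
      ∑ i, Stab.move (f i) (g i) (x i * b i) := by
    rw [Finset.sum_mul]
    refine Finset.sum_congr rfl fun i _ => ?_
    rw [Finset.mul_sum, Finset.sum_eq_single i, Stab.move_mul_move]
    · intro j _ hj
      exact Stab.move_mul_move_of_disjoint _ _ (hg hj.symm) _ _
    · simp
  have h2 : (∑ i, Stab.move (f i) (g i) (x i * b i)) * star (∑ i, Stab.move (f i) (g i) (x i)) =
      ∑ i, Stab.move (f i) (f i) (x i * b i * star (x i)) := by
    rw [star_sum, Finset.sum_mul]
    refine Finset.sum_congr rfl fun i _ => ?_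
    rw [Finset.mul_sum, Finset.sum_eq_single i, Stab.star_move, Stab.move_mul_move]
    · intro j _ hj
      rw [Stab.star_move]
      exact Stab.move_mul_move_of_disjoint _ _ (hg hj.symm) _ _
    · simp
  rw [h1, h2, ← Finset.sum_sub_distrib]
  calc ‖∑ i, (Stab.move (f i) (f i) (x i * b i * star (x i)) - Stab.move (f i) (f i) (a i))‖
      ≤ ∑ i, ε / (Fintype.card ι + 1) := by
        refine (norm_sum_le _ _).trans (Finset.sum_le_sum fun i _ => ?_)
        rw [← map_sub, Stab.norm_move]
        exact (hx i).le
    _ = Fintype.card ι * (ε / (Fintype.card ι + 1)) := by simp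
    _ < ε := by
        rw [mul_div_assoc', div_lt_iff₀ (by positivity)]
        nlinarith

end Sum

/-! ### The Cuntz semigroup -/

section Semigroup

variable (A : Type*) [NonUnitalCStarAlgebra A] [PartialOrder A] [StarOrderedRing A]

/-- The positive cone of `A ⊗ K`, to be preordered by Cuntz subequivalence. -/
structure PosStab where
  /-- The underlying element of `A ⊗ K`. -/
  val : Stab A
  nonneg : 0 ≤ val

variable {A}

variable (A) in
/-- Cuntz subequivalence as a preorder on the positive elements of `A ⊗ K`. -/
instance : Preorder (PosStab A) where
  le a b := CuntzLE a.val b.val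
  le_refl a := CuntzLE.refl a.val
  le_trans _ _ _ := CuntzLE.trans

theorem PosStab.le_def {a b : PosStab A} : a ≤ b ↔ CuntzLE a.val b.val := Iff.rfl

/-- The embedding `k ↦ 2k`. -/
def evenEmb : ℕ ↪ ℕ := ⟨fun k => 2 * k, fun _ _ h => by simpa using h⟩

/-- The embedding `k ↦ 2k + 1`. -/
def oddEmb : ℕ ↪ ℕ := ⟨fun k => 2 * k + 1, fun _ _ h => by simpa using h⟩

instance : Zero (PosStab A) := ⟨⟨0, le_rfl⟩⟩

/-- The orthogonal sum `a ⊕ b`, viewed in `A ⊗ K` by means of the isomorphism `M_2(K) ≅ K` given by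
the bijection of `ℕ ⊔ ℕ` with `ℕ` onto the even and the odd numbers. -/
def PosStab.oplus (a b : PosStab A) : PosStab A :=
  ⟨Stab.move evenEmb evenEmb a.val + Stab.move oddEmb oddEmb b.val,
    add_nonneg (Stab.move_nonneg _ a.nonneg) (Stab.move_nonneg _ b.nonneg)⟩

theorem PosStab.oplus_val (a b : PosStab A) :
    (a.oplus b).val = Stab.move evenEmb evenEmb a.val + Stab.move oddEmb oddEmb b.val := rfl

theorem PosStab.zero_val : (0 : PosStab A).val = 0 := rfl

theorem disjoint_even_odd : Disjoint (Set.range evenEmb) (Set.range oddEmb) := by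
  rw [Set.disjoint_left]
  rintro _ ⟨a, rfl⟩ ⟨b, hb⟩
  change 2 * b + 1 = 2 * a at hb
  omega

theorem CuntzLE.move₂ {f₁ f₂ g₁ g₂ : ℕ ↪ ℕ} (hg : Disjoint (Set.range g₁) (Set.range g₂))
    {a₁ a₂ b₁ b₂ : Stab A} (h₁ : CuntzLE a₁ b₁) (h₂ : CuntzLE a₂ b₂) :
    CuntzLE (Stab.move f₁ f₁ a₁ + Stab.move f₂ f₂ a₂)
      (Stab.move g₁ g₁ b₁ + Stab.move g₂ g₂ b₂) := by
  have := CuntzLE.sum_move ![f₁, f₂] ![g₁, g₂] (a := ![a₁, a₂]) (b := ![b₁, b₂])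
    (by intro i j hij; fin_cases i <;> fin_cases j <;> simp_all [disjoint_comm])
    (by intro i; fin_cases i <;> simpa)
  simpa [Fin.sum_univ_two] using this

theorem CuntzLE.move₃ {f₁ f₂ f₃ g₁ g₂ g₃ : ℕ ↪ ℕ}
    (h₁₂ : Disjoint (Set.range g₁) (Set.range g₂))
    (h₁₃ : Disjoint (Set.range g₁) (Set.range g₃))
    (h₂₃ : Disjoint (Set.range g₂) (Set.range g₃)) (a₁ a₂ a₃ : Stab A) :
    CuntzLE (Stab.move f₁ f₁ a₁ + Stab.move f₂ f₂ a₂ + Stab.move f₃ f₃ a₃)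
      (Stab.move g₁ g₁ a₁ + Stab.move g₂ g₂ a₂ + Stab.move g₃ g₃ a₃) := by
  have := CuntzLE.sum_move ![f₁, f₂, f₃] ![g₁, g₂, g₃] (a := ![a₁, a₂, a₃]) (b := ![a₁, a₂, a₃])
    (by intro i j hij; fin_cases i <;> fin_cases j <;> simp_all [disjoint_comm])
    (fun i => CuntzLE.refl _)
  simpa [Fin.sum_univ_three] using this

theorem PosStab.oplus_le_oplus {a b c d : PosStab A} (h : a ≤ b) (h' : c ≤ d) :
    a.oplus c ≤ b.oplus d :=
  CuntzLE.move₂ disjoint_even_odd h h'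

theorem PosStab.oplus_comm_le (a b : PosStab A) : a.oplus b ≤ b.oplus a := by
  rw [le_def, oplus_val, oplus_val, add_comm]
  exact CuntzLE.move₂ disjoint_even_odd (CuntzLE.refl _) (CuntzLE.refl _)

theorem disjoint_trans_left {f g : ℕ ↪ ℕ} (h : Disjoint (Set.range f) (Set.range g))
    (k : ℕ ↪ ℕ) : Disjoint (Set.range (k.trans f)) (Set.range g) :=
  h.mono_left (by rintro _ ⟨p, rfl⟩; exact ⟨k p, rfl⟩)

theorem disjoint_trans_right {f g : ℕ ↪ ℕ} (h : Disjoint (Set.range f) (Set.range g))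
    (k : ℕ ↪ ℕ) : Disjoint (Set.range f) (Set.range (k.trans g)) :=
  (disjoint_trans_left h.symm k).symm

theorem disjoint_trans {f g : ℕ ↪ ℕ} (h : Disjoint (Set.range f) (Set.range g))
    (k : ℕ ↪ ℕ) : Disjoint (Set.range (f.trans k)) (Set.range (g.trans k)) := by
  rw [Set.disjoint_left] at h ⊢
  rintro _ ⟨a, rfl⟩ ⟨b, hb⟩
  exact h ⟨a, rfl⟩ ⟨b, k.injective hb⟩

theorem PosStab.oplus_assoc (a b c : PosStab A) :
    (a.oplus b).oplus c ≤ a.oplus (b.oplus c) ∧ a.oplus (b.oplus c) ≤ (a.oplus b).oplus c := by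
  have h := disjoint_even_odd
  simp only [le_def, oplus_val, map_add, Stab.move_move, ← add_assoc]
  constructor
  · exact CuntzLE.move₃ (disjoint_trans_right h _) (disjoint_trans_right h _)
      (disjoint_trans h _) _ _ _
  · exact CuntzLE.move₃ (disjoint_trans h _) (disjoint_trans_left h _)
      (disjoint_trans_left h _) _ _ _

theorem PosStab.oplus_zero (a : PosStab A) : a.oplus 0 ≤ a ∧ a ≤ a.oplus 0 := by
  have h : ∀ f g : ℕ ↪ ℕ, CuntzLE (Stab.move f f a.val) (Stab.move g g a.val) := fun f g => by
    simpa using CuntzLE.sum_move (fun _ : Unit => f) (fun _ : Unit => g)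
      (fun i j hij => (hij rfl).elim) (fun _ => CuntzLE.refl a.val)
  simp only [le_def, oplus_val, zero_val, map_zero, add_zero]
  constructor
  · simpa only [Stab.move_refl] using h evenEmb (Function.Embedding.refl ℕ)
  · simpa only [Stab.move_refl] using h (Function.Embedding.refl ℕ) evenEmb

variable (A) in
/-- The Cuntz semigroup `Cu(A)`: the set of Cuntz equivalence classes of positive elements of
`A ⊗ K`, partially ordered by Cuntz subequivalence. -/
def Cu : Type _ := Antisymmetrization (PosStab A) (· ≤ ·)

namespace Cu

instance : PartialOrder (Cu A) :=
  inferInstanceAs (PartialOrder (Antisymmetrization (PosStab A) (· ≤ ·)))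

/-- The class `[a]` of a positive element of `A ⊗ K`. -/
def mk (a : PosStab A) : Cu A := toAntisymmetrization (· ≤ ·) a

theorem mk_le_mk {a b : PosStab A} : mk a ≤ mk b ↔ a ≤ b :=
  toAntisymmetrization_le_toAntisymmetrization_iff

theorem mk_surjective : Function.Surjective (mk : PosStab A → Cu A) := Quotient.mk_surjective

theorem mk_eq_mk {a b : PosStab A} : mk a = mk b ↔ a ≤ b ∧ b ≤ a := by
  rw [le_antisymm_iff, mk_le_mk, mk_le_mk]

instance : Zero (Cu A) := ⟨mk 0⟩

/-- Addition is induced by the orthogonal sum: `[a] + [b] = [a ⊕ b]`. -/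
instance : Add (Cu A) where
  add := Quotient.map₂ PosStab.oplus fun _ _ h _ _ h' =>
    ⟨PosStab.oplus_le_oplus h.1 h'.1, PosStab.oplus_le_oplus h.2 h'.2⟩

theorem mk_add_mk (a b : PosStab A) : mk a + mk b = mk (a.oplus b) := rfl

theorem mk_zero : mk (0 : PosStab A) = 0 := rfl

protected theorem add_comm (x y : Cu A) : x + y = y + x := by
  obtain ⟨a, rfl⟩ := mk_surjective x
  obtain ⟨b, rfl⟩ := mk_surjective y
  exact mk_eq_mk.2 ⟨PosStab.oplus_comm_le a b, PosStab.oplus_comm_le b a⟩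

protected theorem add_zero (x : Cu A) : x + 0 = x := by
  obtain ⟨a, rfl⟩ := mk_surjective x
  exact mk_eq_mk.2 (PosStab.oplus_zero a)

instance : AddCommMonoid (Cu A) where
  add_assoc x y z := by
    obtain ⟨a, rfl⟩ := mk_surjective x
    obtain ⟨b, rfl⟩ := mk_surjective y
    obtain ⟨c, rfl⟩ := mk_surjective z
    exact mk_eq_mk.2 (PosStab.oplus_assoc a b c)
  zero_add x := (Cu.add_comm 0 x).trans (Cu.add_zero x)
  add_zero := Cu.add_zero
  add_comm := Cu.add_comm
  nsmul := nsmulRec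

end Cu

end Semigroup

/-! ### Ordered semigroups and the axioms -/

section Axioms

/-- `S` is a positive ordered abelian semigroup: the order is translation invariant and `0` is the
smallest element. -/
structure IsPositivelyOrdered (S : Type*) [AddCommMonoid S] [PartialOrder S] : Prop where
  add_le_add_right : ∀ s t : S, s ≤ t → ∀ r : S, s + r ≤ t + r
  zero_le : ∀ s : S, 0 ≤ s

/-- Sequential compact containment `s ≪ t`: whenever an increasing sequence has a supremum `u` with
`t ≤ u`, some term of the sequence is above `s`. -/
def CompactlyContained {S : Type*} [PartialOrder S] (s t : S) : Prop :=
  ∀ (v : ℕ → S) (u : S), Monotone v → IsLUB (Set.range v) u → t ≤ u → ∃ n, s ≤ v n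

/-- A rapidly increasing sequence: each term is compactly contained in the next. -/
def RapidlyIncreasing {S : Type*} [PartialOrder S] (v : ℕ → S) : Prop :=
  ∀ n, CompactlyContained (v n) (v (n + 1))

/-- `D` is dense: every element is the supremum of a rapidly increasing sequence of elements
of `D`. -/
def IsDenseSubset {S : Type*} [PartialOrder S] (D : Set S) : Prop :=
  ∀ s : S, ∃ v : ℕ → S, (∀ n, v n ∈ D) ∧ RapidlyIncreasing v ∧ IsLUB (Set.range v) s

variable (S : Type*) [AddCommMonoid S] [PartialOrder S]

/-- Every increasing sequence has a supremum. -/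
def AxiomO1 : Prop := ∀ v : ℕ → S, Monotone v → ∃ s, IsLUB (Set.range v) s

/-- Every element is the supremum of a rapidly increasing sequence. -/
def AxiomO2 : Prop := ∀ s : S, ∃ v : ℕ → S, RapidlyIncreasing v ∧ IsLUB (Set.range v) s

/-- Compact containment is compatible with addition. -/
def AxiomO3 : Prop :=
  ∀ s₁ s₂ t₁ t₂ : S, CompactlyContained s₁ t₁ → CompactlyContained s₂ t₂ →
    CompactlyContained (s₁ + s₂) (t₁ + t₂)

/-- Suprema of increasing sequences are compatible with addition. -/
def AxiomO4 : Prop :=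
  ∀ (v w : ℕ → S) (s t : S), Monotone v → Monotone w →
    IsLUB (Set.range v) s → IsLUB (Set.range w) t → IsLUB (Set.range fun n => v n + w n) (s + t)

/-- Almost algebraic order. -/
def AxiomO5 : Prop :=
  ∀ s' s t : S, CompactlyContained s' s → s ≤ t → ∃ r : S, s' + r ≤ t ∧ t ≤ s + r

/-- Weak Riesz decomposition. -/
def AxiomO6 : Prop :=
  ∀ s r t : S, s ≤ r + t → ∀ s' : S, CompactlyContained s' s →
    ∃ r' t' : S, s' ≤ r' + t' ∧ r' ≤ r ∧ r' ≤ s ∧ t' ≤ t ∧ t' ≤ s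

end Axioms

end Cuntz

end CuntzDefs

/-! Write `a ≾ b` for Cuntz subequivalence. Three mechanisms carry the theorem.

Perturbation. If `‖a - b‖ ≤ δ < ε` with `a` positive and `b` self-adjoint, a positive multiple of
`(a - ε)₊` lies in the operator order below `(a - δ)₊ b (a - δ)₊`. Since `0 ≤ x ≤ y` implies `x ≾ y`
(`CuntzLE.of_le`), this gives `(a - ε)₊ ≾ b` (`CuntzLE.cut_of_conj`, `CuntzLE.cut_of_norm_sub_le`).
Together with `x* x ∼ x x*`, this replaces approximate comparisons by exact ones.

Suprema. If `b₀ ≾ b₁ ≾ ...`, the right ideals generated by the `bₙ`, seen as Hilbert modules, map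
almost isometrically each into the next, and the supremum is their inductive limit. The limit is
realized inside `A ⊗ K`: `exists_gram_limit` builds operators `Tₙ` with range in the `n`-th ideal
whose column blocks carry the transported generators, and the Gram elements `Tₙ* Tₙ` converge in
norm. Hence `exists_sup`: the supremum is represented by a norm limit of elements `Gₙ ≾ bₙ`. This is
more than existence. If `[a]` is below the supremum, then a conjugate of some `Gₙ` is close to `a`,
so by perturbation `[(a - ε)₊] ≪ [a]` (`Cu.compactlyContained_of_le`). Conversely, every `s ≪ [a]`
is below some `[(a - ε)₊]` (`Cu.exists_le_cutPos`).

Cut-downs. O2, O3 and O4 are now statements about `(a - ε)₊`. For O5, `a` is traded for a nearly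
equivalent `a'` of the form `d w d` with `d² = b`; a cutoff function of `a'` then splits `d²` into a
part orthogonal to `(a' - η)₊` and a part below `a'` (`exists_complement`). For O6, an element close
to `a` of the form `x (b ⊕ c) x*` is compressed by a cut-down of `a` and split into its two
summands. For separable `A`, cut-downs of a countable dense set of positive elements interpolate
`≪`. -/

noncomputable section CuntzProof

namespace Cuntz

/-! ### Cuntz comparison in a general C*-algebra -/

section General

variable {B : Type*} [NonUnitalCStarAlgebra B]

theorem CuntzLE.conj (r b : B) : CuntzLE (r * b * star r) b :=
  fun ε hε => ⟨r, by simpa using hε⟩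

theorem CuntzLE.of_approx {a b : B} (h : ∀ ε > 0, ∃ a', ‖a' - a‖ < ε ∧ CuntzLE a' b) :
    CuntzLE a b := by
  intro ε hε
  obtain ⟨a', h1, h2⟩ := h (ε / 2) (half_pos hε)
  obtain ⟨r, hr⟩ := h2 (ε / 2) (half_pos hε)
  refine ⟨r, ?_⟩
  have : r * b * star r - a = (r * b * star r - a') + (a' - a) := by abel
  rw [this]
  exact (norm_add_le _ _).trans_lt (by linarith)

theorem CuntzLE.smul {c : ℝ} (hc : 0 ≤ c) (a : B) : CuntzLE (c • a) a := by
  intro ε hε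
  obtain ⟨r, hr⟩ := CuntzLE.refl a (ε / (c + 1)) (by positivity)
  refine ⟨Real.sqrt c • r, ?_⟩
  have : (Real.sqrt c • r) * a * star (Real.sqrt c • r) - c • a = c • (r * a * star r - a) := by
    rw [star_smul, smul_mul_assoc, smul_mul_assoc, mul_smul_comm, smul_smul, smul_sub]
    simp [Real.mul_self_sqrt hc]
  rw [this, norm_smul, Real.norm_of_nonneg hc]
  rw [lt_div_iff₀ (by positivity)] at hr
  nlinarith [norm_nonneg (r * a * star r - a)]

theorem CuntzLE.of_smul {c : ℝ} (hc : 0 < c) (a : B) : CuntzLE a (c • a) := by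
  have := CuntzLE.smul (inv_nonneg.2 hc.le) (c • a)
  rwa [smul_smul, inv_mul_cancel₀ hc.ne', one_smul] at this

variable [PartialOrder B] [StarOrderedRing B]

/-- For `a ≥ 0` there are elements `k` of the C*-algebra generated by `a` such that `k a² k` is a
contractive approximate unit for `a`. -/
theorem exists_approx_unit {a : B} (ha : 0 ≤ a) {ε : ℝ} (hε : 0 < ε) :
    ∃ k : B, IsSelfAdjoint k ∧ Commute k a ∧ ‖k * (a * a) * k‖ ≤ 1 ∧
      ‖k * (a * a) * k * a - a‖ < ε := by
  set η : ℝ := ε ^ 2 / 4 with hη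
  have hη0 : 0 < η := by positivity
  have hc : Continuous fun t : ℝ => t / (t ^ 2 + η) :=
    continuous_id.div (by fun_prop) fun t => by positivity
  set k := cfcₙ (fun t : ℝ => t / (t ^ 2 + η)) a with hk
  have hsa : IsSelfAdjoint a := .of_nonneg ha
  have hid : cfcₙ (fun t : ℝ => t) a = a := cfcₙ_id' ℝ a
  have e1 : k * (a * a) * k =
      cfcₙ (fun t : ℝ => t / (t ^ 2 + η) * (t * t) * (t / (t ^ 2 + η))) a := by
    rw [cfcₙ_mul (fun t : ℝ => t / (t ^ 2 + η) * (t * t)) _ a (by fun_prop) (by simp)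
      hc.continuousOn (by simp), cfcₙ_mul _ (fun t : ℝ => t * t) a hc.continuousOn (by simp)
      (by fun_prop) (by simp), cfcₙ_mul (fun t : ℝ => t) (fun t : ℝ => t) a, hid]
  refine ⟨k, cfcₙ_predicate _ a, ?_, ?_, ?_⟩
  · have := cfcₙ_commute_cfcₙ (fun t : ℝ => t / (t ^ 2 + η)) (fun t : ℝ => t) a
    rwa [hid] at this
  · rw [e1]
    refine norm_cfcₙ_le fun t _ => ?_
    rw [Real.norm_eq_abs, abs_of_nonneg (by
      have : t / (t ^ 2 + η) * (t * t) * (t / (t ^ 2 + η)) = (t / (t ^ 2 + η) * t) ^ 2 := by ring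
      rw [this]; positivity)]
    have : t / (t ^ 2 + η) * (t * t) * (t / (t ^ 2 + η)) = (t ^ 2 / (t ^ 2 + η)) ^ 2 := by ring
    rw [this]
    have h1 : t ^ 2 / (t ^ 2 + η) ≤ 1 := by
      rw [div_le_one (by positivity)]; linarith
    exact pow_le_one₀ (by positivity) h1
  · have e2 : k * (a * a) * k * a - a =
        cfcₙ (fun t : ℝ => t / (t ^ 2 + η) * (t * t) * (t / (t ^ 2 + η)) * t - t) a := by
      rw [cfcₙ_sub (fun t : ℝ => t / (t ^ 2 + η) * (t * t) * (t / (t ^ 2 + η)) * t) (fun t => t) a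
        (by fun_prop) (by simp) (by fun_prop) (by simp),
        cfcₙ_mul (fun t : ℝ => t / (t ^ 2 + η) * (t * t) * (t / (t ^ 2 + η))) (fun t => t) a
        (by fun_prop) (by simp) (by fun_prop) (by simp), hid, e1]
    rw [e2]
    refine norm_cfcₙ_lt fun t _ => ?_
    have hD : 0 < t ^ 2 + η := by positivity
    have e3 : t / (t ^ 2 + η) * (t * t) * (t / (t ^ 2 + η)) * t - t =
        -(t * (η * (2 * t ^ 2 + η)) / (t ^ 2 + η) ^ 2) := by
      field_simp
      ring
    rw [e3, norm_neg, norm_div, norm_mul, Real.norm_eq_abs, Real.norm_of_nonneg (by positivity),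
      Real.norm_of_nonneg (by positivity), div_lt_iff₀ (by positivity)]
    have hs : t ^ 2 = |t| ^ 2 := (sq_abs t).symm
    rw [hs]
    set u := |t|
    have hu : 0 ≤ u := abs_nonneg t
    have hηe : η = (ε / 2) ^ 2 := by rw [hη]; ring
    have h1 : u * (ε / 2) * 2 ≤ u ^ 2 + η := by rw [hηe]; nlinarith [sq_nonneg (u - ε / 2)]
    have h2 : u * η * 2 ≤ (ε / 2) * (u ^ 2 + η) := by
      calc u * η * 2 = (ε / 2) * (u * (ε / 2) * 2) := by rw [hηe]; ring
        _ ≤ _ := by gcongr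
    calc u * (η * (2 * u ^ 2 + η)) ≤ u * (η * (2 * (u ^ 2 + η))) := by gcongr; linarith
      _ = u * η * 2 * (u ^ 2 + η) := by ring
      _ ≤ (ε / 2) * (u ^ 2 + η) * (u ^ 2 + η) := by gcongr
      _ < ε * (u ^ 2 + η) ^ 2 := by
        have : 0 < (u ^ 2 + η) ^ 2 := by positivity
        nlinarith

/-- The approximate unit `k a² k` has `k` commuting with `a`, so `k a³ k = (k a² k) a` is close to
`a`. The cube is used because it is reached without roots; the square follows from `a³ = √a a² √a`.
-/
theorem CuntzLE.le_cube {a : B} (ha : 0 ≤ a) : CuntzLE a (a * a * a) := by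
  intro ε hε
  obtain ⟨k, hk, hc, -, h⟩ := exists_approx_unit ha hε
  refine ⟨k, ?_⟩
  rw [hk.star_eq]
  have : k * (a * a * a) * k = k * (a * a) * k * a := by
    rw [mul_assoc (k * (a * a)), hc.eq]; simp only [mul_assoc]
  rwa [this]

theorem CuntzLE.le_mul_self {a : B} (ha : 0 ≤ a) : CuntzLE a (a * a) := by
  refine (CuntzLE.le_cube ha).trans ?_
  have h := CFC.sqrt_mul_sqrt_self a ha
  have hs : IsSelfAdjoint (CFC.sqrt a) := .of_nonneg (CFC.sqrt_nonneg a)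
  have := CuntzLE.conj (CFC.sqrt a) (a * a)
  rw [hs.star_eq] at this
  convert this using 1
  generalize CFC.sqrt a = s at h
  simp only [← h, mul_assoc]

theorem CuntzLE.mul_self_le {a : B} (ha : 0 ≤ a) : CuntzLE (a * a) a := by
  have h := CFC.sqrt_mul_sqrt_self a ha
  have hs : IsSelfAdjoint (CFC.sqrt a) := .of_nonneg (CFC.sqrt_nonneg a)
  have := CuntzLE.conj (CFC.sqrt a) a
  rw [hs.star_eq] at this
  convert this using 1
  generalize CFC.sqrt a = s at h
  simp only [← h, mul_assoc]

theorem CuntzLE.mul_star_le (x : B) : CuntzLE (x * star x) (star x * x) := by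
  refine (CuntzLE.le_mul_self (mul_star_self_nonneg x)).trans ?_
  convert CuntzLE.conj x (star x * x) using 1
  simp only [mul_assoc]

theorem CuntzLE.star_mul_le (x : B) : CuntzLE (star x * x) (x * star x) := by
  simpa using CuntzLE.mul_star_le (star x)

/-- A positive element of the right ideal `d B` is below `d²`: `z² = (d s)(d s)*` is equivalent to
`(d s)* (d s) = s* d² s`. -/
theorem CuntzLE.of_eq_mul {z d s : B} (hz : 0 ≤ z) (hd : IsSelfAdjoint d) (h : z = d * s) :
    CuntzLE z (d * d) := by
  refine (CuntzLE.le_mul_self hz).trans ?_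
  have e : z * z = (d * s) * star (d * s) := by
    rw [← h, (IsSelfAdjoint.of_nonneg hz).star_eq]
  rw [e]
  refine (CuntzLE.mul_star_le _).trans ?_
  convert CuntzLE.conj (star s) (d * d) using 1
  rw [star_mul, star_star, hd.star_eq]
  simp only [mul_assoc]

/-- An approximate unit `h` for `b` is also one for `√a`, because `(1 - h) a (1 - h) ≤ (1 - h) b (1
- h)`; the element `√a h √a` is a conjugate of `b`. -/
theorem CuntzLE.of_le {a b : B} (ha : 0 ≤ a) (hab : a ≤ b) : CuntzLE a b := by
  intro ε hε
  have hb := ha.trans hab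
  obtain ⟨x, hx, hx'⟩ : ∃ x : B, IsSelfAdjoint x ∧ x * x = a :=
    ⟨CFC.sqrt a, .of_nonneg (CFC.sqrt_nonneg a), CFC.sqrt_mul_sqrt_self a ha⟩
  obtain ⟨y, hy, hy'⟩ : ∃ x : B, IsSelfAdjoint x ∧ x * x = b :=
    ⟨CFC.sqrt b, .of_nonneg (CFC.sqrt_nonneg b), CFC.sqrt_mul_sqrt_self b hb⟩
  -- The estimate controls `‖z‖²`, while the error is `‖x z‖`; hence the square of `ε / (‖x‖ + 1)`.
  set δ : ℝ := ε ^ 2 / (2 * (‖x‖ + 1) ^ 2) with hδ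
  have hδ0 : 0 < δ := by positivity
  obtain ⟨k, hk, hc, h1, h2⟩ := exists_approx_unit hb (ε := δ / 2) (by positivity)
  set h := k * (b * b) * k with hh
  have hhsa : star h = h := by
    simp only [hh, star_mul, hk.star_eq, (IsSelfAdjoint.of_nonneg hb).star_eq, mul_assoc]
  refine ⟨x * k * y, ?_⟩
  have e1 : x * k * y * b * star (x * k * y) = x * h * x := by
    simp only [star_mul, hk.star_eq, hx.star_eq, hy.star_eq, hh, ← hy', mul_assoc]
  rw [e1]
  set z := x - h * x with hz
  have e2 : x * h * x - a = - (x * z) := by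
    rw [hz, ← hx']; noncomm_ring
  have e3 : z * star z = a - h * a - (a - h * a) * h := by
    rw [hz, star_sub, star_mul, hhsa, hx.star_eq, ← hx']; noncomm_ring
  have e4 : z * star z ≤ b - h * b - (b - h * b) * h := by
    obtain ⟨w, hw⟩ := CStarAlgebra.nonneg_iff_eq_star_mul_self.1 (sub_nonneg.2 hab)
    rw [e3, ← sub_nonneg]
    have : (b - h * b - (b - h * b) * h) - (a - h * a - (a - h * a) * h) =
        star (w - w * h) * (w - w * h) := by
      have : star (w - w * h) * (w - w * h) =
          star w * w - h * (star w * w) - (star w * w - h * (star w * w)) * h := by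
        rw [star_sub, star_mul, hhsa]; noncomm_ring
      rw [this, ← hw]; noncomm_ring
    rw [this]
    exact star_mul_self_nonneg _
  have h2' : ‖b - h * b‖ < δ / 2 := by rwa [norm_sub_rev]
  have e5 : ‖z * star z‖ < δ := by
    calc ‖z * star z‖ ≤ ‖b - h * b - (b - h * b) * h‖ :=
          CStarAlgebra.norm_le_norm_of_nonneg_of_le (mul_star_self_nonneg z) e4
      _ ≤ ‖b - h * b‖ + ‖b - h * b‖ * ‖h‖ :=
          (norm_sub_le _ _).trans (by gcongr; exact norm_mul_le _ _)
      _ ≤ ‖b - h * b‖ + ‖b - h * b‖ * 1 := by gcongr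
      _ < δ := by linarith
  rw [CStarRing.norm_self_mul_star] at e5
  rw [e2, norm_neg]
  refine (norm_mul_le _ _).trans_lt ?_
  have h6 : (‖x‖ + 1) * ‖z‖ < ε := by
    refine lt_of_pow_lt_pow_left₀ 2 hε.le ?_
    rw [hδ, lt_div_iff₀ (by positivity)] at e5
    nlinarith [sq_nonneg ((‖x‖ + 1) * ‖z‖)]
  nlinarith [norm_nonneg z]

/-- A lower bound of `e a e* - δ e e*` stays below `e b e*` for all `b` within `δ` of `a`. -/
theorem le_conj_of_norm_sub_le {a b x e : B} (ha : IsSelfAdjoint a) (hb : IsSelfAdjoint b) {δ : ℝ}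
    (hab : ‖a - b‖ ≤ δ) (h : x ≤ e * a * star e - δ • (e * star e)) : x ≤ e * b * star e := by
  refine h.trans ?_
  have h1 : e * (a - b) * star e ≤ ‖a - b‖ • (e * star e) := by
    simpa using CStarAlgebra.star_left_conjugate_le_norm_smul (a := star e) (b := a - b)
      (ha.sub hb)
  have h2 : ‖a - b‖ • (e * star e) ≤ δ • (e * star e) :=
    smul_le_smul_of_nonneg_right hab (mul_star_self_nonneg e)
  have h3 := h1.trans h2
  rw [mul_sub, sub_mul, sub_le_iff_le_add] at h3
  rw [sub_le_iff_le_add, add_comm]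
  exact h3

theorem CuntzLE.of_norm_sub_le {a b x e : B} (ha : IsSelfAdjoint a) (hb : IsSelfAdjoint b)
    (hx : 0 ≤ x) {δ : ℝ} (hab : ‖a - b‖ ≤ δ) (h : x ≤ e * a * star e - δ • (e * star e)) :
    CuntzLE x b :=
  (CuntzLE.of_le hx (le_conj_of_norm_sub_le ha hb hab h)).trans (CuntzLE.conj e b)

/-! ### Cut-downs and perturbation -/

/-- The element `(a - ε)₊`. -/
def cut (ε : ℝ) (a : B) : B := cfcₙ (fun t : ℝ => max (t - ε) 0) a

theorem cut_nonneg (ε : ℝ) (a : B) : 0 ≤ cut ε a :=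
  cfcₙ_nonneg fun _ _ => le_max_right _ _

theorem cut_isSelfAdjoint (ε : ℝ) (a : B) : IsSelfAdjoint (cut ε a) := .of_nonneg (cut_nonneg ε a)

theorem cut_zero {a : B} (ha : 0 ≤ a) : cut 0 a = a := by
  rw [cut]
  conv_rhs => rw [← cfcₙ_id' ℝ a (.of_nonneg ha)]
  exact cfcₙ_congr fun t ht => by simp [quasispectrum_nonneg_of_nonneg a ha t ht]

theorem norm_cut_sub_le {a : B} (ha : 0 ≤ a) {ε : ℝ} (hε : 0 ≤ ε) : ‖cut ε a - a‖ ≤ ε := by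
  have hsa : IsSelfAdjoint a := .of_nonneg ha
  have : cut ε a - a = cfcₙ (fun t : ℝ => max (t - ε) 0 - t) a := by
    rw [cfcₙ_sub (fun t : ℝ => max (t - ε) 0) (fun t => t) a (by fun_prop) (by simp [hε])
      (by fun_prop) (by simp), cfcₙ_id' ℝ a, cut]
  rw [this]
  refine norm_cfcₙ_le fun t ht => ?_
  have := quasispectrum_nonneg_of_nonneg a ha t ht
  rw [Real.norm_eq_abs, abs_le]
  rcases max_cases (t - ε) 0 with h | h <;> constructor <;> linarith

theorem cut_cut {a : B} (ha : 0 ≤ a) {ε δ : ℝ} (hε : 0 ≤ ε) (hδ : 0 ≤ δ) :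
    cut ε (cut δ a) = cut (δ + ε) a := by
  have hsa : IsSelfAdjoint a := .of_nonneg ha
  rw [cut, cut, cut, ← cfcₙ_comp' (fun t : ℝ => max (t - ε) 0) (fun t : ℝ => max (t - δ) 0) a
    (by fun_prop) (by simp [hε]) (by fun_prop) (by simp [hδ])]
  refine cfcₙ_congr fun t ht => ?_
  rcases max_cases (t - δ) 0 with h | h <;> rcases max_cases (t - (δ + ε)) 0 with h' | h' <;>
    rw [h.1, h'.1] <;>
    first
    | (rw [max_eq_left (by linarith)]; linarith)
    | (rw [max_eq_right (by linarith)])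

theorem cut_le_cut {a : B} (ha : 0 ≤ a) {ε δ : ℝ} (hδ : 0 ≤ δ) (h : δ ≤ ε) :
    cut ε a ≤ cut δ a := by
  have hsa : IsSelfAdjoint a := .of_nonneg ha
  refine cfcₙ_mono (fun t _ => ?_) (by fun_prop) (by fun_prop) (by simp [hδ.trans h]) (by simp [hδ])
  exact max_le_max (by linarith) le_rfl

theorem cut_le {a : B} (ha : 0 ≤ a) {ε : ℝ} (hε : 0 ≤ ε) : cut ε a ≤ a := by
  simpa [cut_zero ha] using cut_le_cut ha le_rfl hε

/-- `cut δ a` witnesses that `cut ε a` stays below perturbations of `a` of size `δ`. -/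
theorem smul_cut_le {a : B} (ha : 0 ≤ a) {ε δ : ℝ} (hδ : 0 ≤ δ) (hε : δ ≤ ε) :
    (ε - δ) ^ 2 • cut ε a ≤
      cut δ a * a * star (cut δ a) - δ • (cut δ a * star (cut δ a)) := by
  have hsa : IsSelfAdjoint a := .of_nonneg ha
  have hid : cfcₙ (fun t : ℝ => t) a = a := cfcₙ_id' ℝ a
  rw [(cut_isSelfAdjoint δ a).star_eq]
  have e : cut δ a * a * cut δ a - δ • (cut δ a * cut δ a) =
      cfcₙ (fun t : ℝ => max (t - δ) 0 * t * max (t - δ) 0 -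
        δ • (max (t - δ) 0 * max (t - δ) 0)) a := by
    rw [cfcₙ_sub (fun t : ℝ => max (t - δ) 0 * t * max (t - δ) 0)
        (fun t : ℝ => δ • (max (t - δ) 0 * max (t - δ) 0)) a
        (by fun_prop) (by simp) (by fun_prop) (by simp [hδ]),
      cfcₙ_smul δ (fun t : ℝ => max (t - δ) 0 * max (t - δ) 0) a (by fun_prop) (by simp [hδ]),
      cfcₙ_mul (fun t : ℝ => max (t - δ) 0 * t) (fun t : ℝ => max (t - δ) 0) a (by fun_prop)
        (by simp) (by fun_prop) (by simp [hδ]),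
      cfcₙ_mul (fun t : ℝ => max (t - δ) 0) (fun t : ℝ => t) a (by fun_prop)
        (by simp [hδ]) (by fun_prop) (by simp),
      cfcₙ_mul (fun t : ℝ => max (t - δ) 0) (fun t : ℝ => max (t - δ) 0) a (by fun_prop)
        (by simp [hδ]) (by fun_prop) (by simp [hδ]), hid]
    rfl
  rw [e, cut, ← cfcₙ_smul ((ε - δ) ^ 2) (fun t : ℝ => max (t - ε) 0) a (by fun_prop)
    (by simp [hδ.trans hε])]
  -- The right side is `(t - δ)₊³`. Where `t ≥ ε`, two of its factors are at least `ε - δ` and the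
  -- third is at least `t - ε`.
  refine cfcₙ_mono (fun t ht => ?_) (by fun_prop) (by fun_prop) (by simp [hδ.trans hε]) (by simp [hδ])
  have ht0 := quasispectrum_nonneg_of_nonneg a ha t ht
  simp only [smul_eq_mul]
  rcases max_cases (t - ε) 0 with h | h
  · rw [h.1, max_eq_left (by linarith)]
    have h1 : (ε - δ) ^ 2 ≤ (t - δ) ^ 2 := by
      apply pow_le_pow_left₀ <;> linarith
    nlinarith
  · rw [h.1, mul_zero]
    rcases max_cases (t - δ) 0 with h' | h'
    · rw [h'.1]
      have : (t - δ) * t * (t - δ) - δ * ((t - δ) * (t - δ)) = (t - δ) ^ 3 := by ring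
      rw [this]
      exact pow_nonneg h'.2 3
    · rw [h'.1]; simp

/-- Keeping the compression on the right, instead of only `b`, is what O5 and O6 need: for positive
`b` the compressed element is below `a` as well (`CuntzLE.cut_conj_le`). -/
theorem CuntzLE.cut_of_conj {a b : B} (ha : 0 ≤ a) (hb : IsSelfAdjoint b) {ε δ : ℝ} (hδ : 0 ≤ δ)
    (hε : δ < ε) (hab : ‖a - b‖ ≤ δ) : CuntzLE (cut ε a) (cut δ a * b * cut δ a) := by
  have h1 := le_conj_of_norm_sub_le (.of_nonneg ha) hb hab (smul_cut_le ha hδ hε.le)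
  rw [(cut_isSelfAdjoint δ a).star_eq] at h1
  have h2 : 0 < (ε - δ) ^ 2 := pow_pos (sub_pos.2 hε) 2
  exact (CuntzLE.of_smul h2 _).trans
    (CuntzLE.of_le (smul_nonneg h2.le (cut_nonneg ε a)) h1)

theorem CuntzLE.cut_of_norm_sub_le {a b : B} (ha : 0 ≤ a) (hb : IsSelfAdjoint b) {ε δ : ℝ}
    (hδ : 0 ≤ δ) (hε : δ < ε) (hab : ‖a - b‖ ≤ δ) : CuntzLE (cut ε a) b := by
  refine (CuntzLE.cut_of_conj ha hb hδ hε hab).trans ?_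
  simpa [(cut_isSelfAdjoint δ a).star_eq] using CuntzLE.conj (cut δ a) b

/-- Compressions by `(a - δ)₊` are Cuntz below `a`. -/
theorem CuntzLE.cut_conj_le {a b : B} (ha : 0 ≤ a) (hb : 0 ≤ b) {δ : ℝ} (hδ : 0 ≤ δ) :
    CuntzLE (cut δ a * b * cut δ a) a := by
  have hc := cut_isSelfAdjoint δ a
  refine (CuntzLE.of_eq_mul (hc.conjugate_nonneg hb) hc (mul_assoc _ _ _)).trans ?_
  exact (CuntzLE.mul_self_le (cut_nonneg δ a)).trans (CuntzLE.of_le (cut_nonneg δ a) (cut_le ha hδ))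

theorem CuntzLE.of_cut {a b : B} (ha : 0 ≤ a) (h : ∀ ε > 0, CuntzLE (cut ε a) b) : CuntzLE a b :=
  CuntzLE.of_approx fun ε hε => ⟨cut (ε / 2) a,
    (norm_cut_sub_le ha (half_pos hε).le).trans_lt (half_lt_self hε), h _ (half_pos hε)⟩

/-- The complement used for almost algebraic order: if `a = d w d`, then `d²` splits up
to Cuntz equivalence over `a`. -/
theorem exists_complement {d w a : B} (hd : IsSelfAdjoint d) (ha : 0 ≤ a) (h : a = d * w * d)
    {η : ℝ} (hη : 0 < η) :
    ∃ c g : B, 0 ≤ c ∧ 0 ≤ g ∧ cut η a * c = 0 ∧ CuntzLE (cut η a + c) (d * d) ∧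
      CuntzLE (d * d) (c + g) ∧ CuntzLE g a := by
  have hsa : IsSelfAdjoint a := .of_nonneg ha
  have hid : cfcₙ (fun t : ℝ => t) a = a := cfcₙ_id' ℝ a
  -- `g₀ = a * q` is the cutoff function that is `1` on `[η, ∞)`.
  set q := cfcₙ (fun t : ℝ => t / max (t ^ 2) (η ^ 2)) a with hq
  have hpos : ∀ t : ℝ, 0 < max (t ^ 2) (η ^ 2) := fun t => lt_max_of_lt_right (by positivity)
  have hqc : Continuous fun t : ℝ => t / max (t ^ 2) (η ^ 2) :=
    continuous_id.div (by fun_prop) fun t => (hpos t).ne'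
  have hqsa : IsSelfAdjoint q := cfcₙ_predicate _ a
  have hqa : Commute q a := by
    have := cfcₙ_commute_cfcₙ (fun t : ℝ => t / max (t ^ 2) (η ^ 2)) (fun t : ℝ => t) a
    rwa [hid] at this
  set g₀ := a * q with hg₀
  have hg₀sa : star g₀ = g₀ := by rw [hg₀, star_mul, hqsa.star_eq, hsa.star_eq, hqa.eq]
  have hg₀c : g₀ = cfcₙ (fun t : ℝ => t * (t / max (t ^ 2) (η ^ 2))) a := by
    rw [cfcₙ_mul (fun t : ℝ => t) _ a (by fun_prop) (by simp) hqc.continuousOn (by simp), hid]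
  have hcutg : cut η a * g₀ = cut η a := by
    rw [hg₀c, cut, ← cfcₙ_mul (fun t : ℝ => max (t - η) 0) _ a (by fun_prop) (by simp [hη.le])
      (by fun_prop) (by simp)]
    refine cfcₙ_congr fun t _ => ?_
    rcases max_cases (t - η) 0 with h | h
    · have ht : 0 < t := by linarith
      rw [max_eq_left (a := t ^ 2) (by apply pow_le_pow_left₀ <;> linarith)]
      field_simp
    · rw [h.1, zero_mul]
  obtain ⟨p, hp⟩ : ∃ p, cut η a = a * p := by
    refine ⟨cfcₙ (fun t : ℝ => max (t - η) 0 / max (t ^ 2) (η ^ 2)* t ) a, ?_⟩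
    have hc : Continuous fun t : ℝ => max (t - η) 0 / max (t ^ 2) (η ^ 2) :=
      Continuous.div (by fun_prop) (by fun_prop) fun t => (hpos t).ne'
    have := cfcₙ_mul (fun t : ℝ => t) (fun t : ℝ => max (t - η) 0 / max (t ^ 2) (η ^ 2) * t) a
      (by fun_prop) (by simp) (by fun_prop) (by simp)
    rw [hid] at this
    rw [← this, cut]
    refine cfcₙ_congr fun t _ => ?_
    rcases max_cases (t - η) 0 with h | h
    · have ht : 0 < t := by linarith
      rw [max_eq_left (a := t ^ 2) (by apply pow_le_pow_left₀ <;> linarith)]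
      field_simp
    · rw [h.1]; simp
  -- Formally `y = d (1 - g₀)`. The complement is `c = (1 - g₀) d² (1 - g₀)` and the remainder is `g
  -- = g₀ d² g₀`.
  set y := d - d * g₀ with hy
  have hys : star y = d - g₀ * d := by rw [hy, star_sub, star_mul, hg₀sa, hd.star_eq]
  have hz : 0 ≤ star g₀ * (d * d) * g₀ := by
    refine star_left_conjugate_nonneg ?_ _
    simpa [hd.star_eq] using star_mul_self_nonneg d
  refine ⟨star y * y, star g₀ * (d * d) * g₀, star_mul_self_nonneg _, hz, ?_, ?_, ?_, ?_⟩
  · rw [← mul_assoc, hys, mul_sub (cut η a), ← mul_assoc, hcutg, sub_self, zero_mul]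
  -- Since `a = d w d` starts with `d`, so do `cut η a = a p` and `c = d y - a q d y`; `s` collects
  -- what follows that factor.
  · refine CuntzLE.of_eq_mul (s := w * d * p + (y - w * d * q * d * y))
      (add_nonneg (cut_nonneg _ _) (star_mul_self_nonneg _)) hd ?_
    rw [hp, hys, hg₀, h]
    noncomm_ring
  · refine (CuntzLE.of_le (b := (2 : ℝ) • (star y * y + star g₀ * (d * d) * g₀)) ?_ ?_).trans
      (CuntzLE.smul zero_le_two _)
    · simpa [hd.star_eq] using star_mul_self_nonneg d
    -- With `u = 1 - g₀` and `v = g₀`, so `u + v = 1`: `2 (u d² u + v d² v) - d² = (u - v) d² (u -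
    -- v)`.
    · rw [← sub_nonneg]
      have : (2 : ℝ) • (star y * y + star g₀ * (d * d) * g₀) - d * d =
          star (y - d * g₀) * (y - d * g₀) := by
        have hs : star (y - d * g₀) = d - g₀ * d - g₀ * d := by
          rw [star_sub, hys, star_mul, hd.star_eq, hg₀sa]
        rw [hs, hys, hg₀sa, two_smul, hy]
        noncomm_ring
      rw [this]
      exact star_mul_self_nonneg _
  · refine (CuntzLE.of_eq_mul (s := q * (d * d) * g₀) hz hsa ?_).trans (CuntzLE.mul_self_le ha)
    rw [hg₀sa]
    simp only [hg₀, mul_assoc]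

end General

end Cuntz

end CuntzProof

noncomputable section CuntzProof

namespace Cuntz

open Filter Topology

/-! ### Suprema as inductive limits of Hilbert modules -/

section Limit

variable {B : Type*} [NonUnitalCStarAlgebra B] [PartialOrder B] [StarOrderedRing B]

/-- If `d² ≾ d'²` then elements of `d B` can be transported almost isometrically into `d' B`. -/
theorem exists_transport {d d' : B} (hd : 0 ≤ d) (hd' : IsSelfAdjoint d')
    (h : CuntzLE (d * d) (d' * d')) (s : B) {δ : ℝ} (hδ : 0 < δ) :
    ∃ ρ : B, ‖star (d' * (ρ * (d * s))) * (d' * (ρ * (d * s))) - star (d * s) * (d * s)‖ < δ := by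
  have hds : IsSelfAdjoint d := .of_nonneg hd
  obtain ⟨k, hk, hc, -, h1⟩ := exists_approx_unit hd
    (ε := δ / (2 * (‖s‖ ^ 2 * ‖d‖ + 1))) (by positivity)
  obtain ⟨r, hr⟩ := h (δ / (2 * (‖k * (d * s)‖ ^ 2 + 1))) (by positivity)
  -- The Gram element becomes `s* d k (r d'² r*) k d s`, which is close to `s* d (k d² k d) s` and
  -- then to `s* d² s`. The tolerance for `r` depends on `‖k d s‖`, so `k` is fixed first.
  refine ⟨star r * k, ?_⟩
  have e : star (d' * (star r * k * (d * s))) * (d' * (star r * k * (d * s))) -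
      star (d * s) * (d * s) =
      star (k * (d * s)) * (r * (d' * d') * star r - d * d) * (k * (d * s)) +
        star s * d * (k * (d * d) * k * d - d) * s := by
    simp only [star_mul, star_star, hds.star_eq, hk.star_eq, hd'.star_eq]
    noncomm_ring
  rw [e]
  rw [lt_div_iff₀ (by positivity)] at h1 hr
  calc _ ≤ ‖k * (d * s)‖ * ‖r * (d' * d') * star r - d * d‖ * ‖k * (d * s)‖ +
        ‖s‖ * ‖d‖ * ‖k * (d * d) * k * d - d‖ * ‖s‖ := by
        refine (norm_add_le _ _).trans (add_le_add ?_ ?_)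
        · refine (norm_mul_le _ _).trans ?_
          gcongr
          exact (norm_mul_le _ _).trans (by rw [norm_star])
        · refine (norm_mul_le _ _).trans ?_
          gcongr
          refine (norm_mul_le _ _).trans ?_
          gcongr
          exact (norm_mul_le _ _).trans (by rw [norm_star])
    _ < δ := by
        have := norm_nonneg (r * (d' * d') * star r - d * d)
        have := norm_nonneg (k * (d * d) * k * d - d)
        nlinarith

end Limit

variable {A : Type*} [NonUnitalCStarAlgebra A] [PartialOrder A] [StarOrderedRing A]

/-- The embedding of `ℕ` onto the `i`-th row of `ℕ × ℕ ≅ ℕ`. -/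
def colEmb (i : ℕ) : ℕ ↪ ℕ := ⟨fun k => Nat.pair i k, fun _ _ h => (Nat.pair_eq_pair.1 h).2⟩

theorem disjoint_colEmb {i j : ℕ} (h : i ≠ j) :
    Disjoint (Set.range (colEmb i)) (Set.range (colEmb j)) := by
  rw [Set.disjoint_left]
  rintro _ ⟨a, rfl⟩ ⟨b, hb⟩
  exact h (Nat.pair_eq_pair.1 hb).1.symm

namespace Stab

/-- Place `x` in the `i`-th column block. -/
def col (i : ℕ) : Stab A →L[ℂ] Stab A := move (.refl ℕ) (colEmb i)

theorem col_mul_star_col (i : ℕ) (x y : Stab A) : col i x * star (col i y) = x * star y := by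
  rw [col, star_move, move_mul_move, move_refl]

theorem col_mul_star_col_of_ne {i j : ℕ} (h : i ≠ j) (x y : Stab A) :
    col i x * star (col j y) = 0 := by
  rw [col, col, star_move, move_mul_move_of_disjoint _ _ (disjoint_colEmb h)]

theorem mul_col (i : ℕ) (d x : Stab A) : d * col i x = col i (d * x) := by
  conv_lhs => rw [← move_refl d]
  rw [col, move_mul_move]

theorem norm_col (i : ℕ) (x : Stab A) : ‖col i x‖ = ‖x‖ := norm_move _ _ _

end Stab

open Stab

/-- Transport tolerances for the construction below: the `4⁻ⁿ` bound keeps norms growing by a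
summable amount after a square root, and the last bound makes all errors after stage `m` sum to at
most `τ m`. -/
theorem exists_pos_le_of_le {τ : ℕ → ℝ} (hτ : ∀ n, 0 < τ n) :
    ∃ σ : ℕ → ℝ, (∀ n, 0 < σ n) ∧ (∀ n, σ n ≤ (1 / 4) ^ n) ∧
      ∀ m n, m ≤ n → σ n ≤ (1 / 2) ^ (n + 1) * τ m := by
  set μ : ℕ → ℝ := fun n => (Finset.range (n + 1)).inf' (by simp) τ
  have hμ : ∀ n, 0 < μ n := fun n => (Finset.lt_inf'_iff _).2 fun i _ => hτ i
  have hle : ∀ n : ℕ, (1 / 4 : ℝ) ^ n * (1 / 2) ≤ (1 / 2) ^ (n + 1) := fun n => by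
    rw [pow_succ]
    gcongr
    norm_num
  refine ⟨fun n => (1 / 4) ^ n * (1 / 2) * min 1 (μ n), fun n => ?_, fun n => ?_,
    fun m n hmn => ?_⟩
  · have := lt_min one_pos (hμ n)
    positivity
  · have h1 := pow_pos (show (0 : ℝ) < 1 / 4 by norm_num) n
    have h2 := min_le_left 1 (μ n)
    have h3 := lt_min one_pos (hμ n)
    nlinarith
  · have h1 : min 1 (μ n) ≤ τ m :=
      (min_le_right _ _).trans (Finset.inf'_le _ (by simpa [Nat.lt_succ_iff] using hmn))
    exact mul_le_mul (hle n) h1 (lt_min one_pos (hμ n)).le (by positivity)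

/-- The inductive limit of the right ideals generated by `d n`, realized by Gram matrices. -/
theorem exists_gram_limit {d : ℕ → Stab A} (hd : ∀ n, 0 ≤ d n) (hn : ∀ n, ‖d n‖ ≤ (1 / 2) ^ n)
    (hle : ∀ n, CuntzLE (d n * d n) (d (n + 1) * d (n + 1))) {τ : ℕ → ℝ} (hτ : ∀ n, 0 < τ n) :
    ∃ (s : ℕ → Stab A) (g : Stab A),
      Tendsto (fun n => star (d n * s n) * (d n * s n)) atTop (𝓝 g) ∧
      ∀ m r, ‖col m r * g * star (col m r) - r * (d m * d m * (d m * d m)) * star r‖ ≤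
        ‖r‖ ^ 2 * τ m := by
  obtain ⟨σ, hσ, hσ4, hστ⟩ := exists_pos_le_of_le hτ
  have hsa : ∀ n, star (d n) = d n := fun n => (IsSelfAdjoint.of_nonneg (hd n)).star_eq
  choose ρ hρ using fun n s =>
    exists_transport (hd n) (.of_nonneg (hd (n + 1))) (hle n) s (hσ n)
  -- Each step transports the previous operator into the next ideal by `ρ` and adds the new
  -- generator in a fresh column block, so block `m ≤ n` of `d n * s n` holds the transported `d m *
  -- d m`.
  let s : ℕ → Stab A := fun n => Nat.rec (col 0 (d 0))
    (fun n x => ρ n x * (d n * x) + col (n + 1) (d (n + 1))) n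
  have hs : ∀ n, s (n + 1) = ρ n (s n) * (d n * s n) + col (n + 1) (d (n + 1)) := fun _ => rfl
  set T : ℕ → Stab A := fun n => d n * s n with hT
  set Y : ℕ → Stab A := fun n => d (n + 1) * (ρ n (s n) * T n) with hY
  set C : ℕ → Stab A := fun n => col n (d n * d n) with hC
  have hT0 : T 0 = C 0 := mul_col _ _ _
  have hTs : ∀ n, T (n + 1) = Y n + C (n + 1) := fun n => by
    simp only [hT, hY, hC, hs, mul_add, mul_col]
  have hYT : ∀ n, ‖star (Y n) * Y n - star (T n) * T n‖ ≤ σ n := fun n => (hρ n (s n)).le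
  have hhalf : ∀ n : ℕ, (1 / 2 : ℝ) ^ n ≤ 1 := fun n => pow_le_one₀ (by norm_num) (by norm_num)
  have hCn : ∀ n, ‖C n‖ ≤ (1 / 2) ^ n := fun n => by
    rw [hC, norm_col]
    calc ‖d n * d n‖ ≤ ‖d n‖ * ‖d n‖ := norm_mul_le _ _
      _ ≤ (1 / 2) ^ n * 1 := by gcongr <;> [exact hn n; exact (hn n).trans (hhalf n)]
      _ = _ := mul_one _
  have hC1 : ∀ n, ‖C (n + 1)‖ ≤ (1 / 2) ^ n := fun n => (hCn _).trans <| by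
    rw [pow_succ]; nlinarith [pow_pos (one_half_pos (α := ℝ)) n]
  have hYn : ∀ n, ‖Y n‖ ≤ ‖T n‖ + (1 / 2) ^ n := fun n => by
    refine le_of_sq_le_sq ?_ (by positivity)
    have h1 : ‖star (Y n) * Y n‖ ≤ ‖star (T n) * T n‖ + (1 / 4) ^ n := by
      have e : star (Y n) * Y n = star (T n) * T n + (star (Y n) * Y n - star (T n) * T n) := by
        abel
      rw [e]
      exact (norm_add_le _ _).trans (by gcongr; exact (hYT n).trans (hσ4 n))
    rw [CStarRing.norm_star_mul_self, CStarRing.norm_star_mul_self] at h1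
    have h2 : (1 / 4 : ℝ) ^ n = (1 / 2) ^ n * (1 / 2) ^ n := by rw [← mul_pow]; norm_num
    nlinarith [mul_nonneg (norm_nonneg (T n)) (pow_pos (one_half_pos (α := ℝ)) n).le]
  -- A step adds at most `2 · 2⁻ⁿ`, which is exactly the increase of the right side.
  have hTn : ∀ n, ‖T n‖ ≤ 5 - 4 * (1 / 2) ^ n := fun n => by
    induction n with
    | zero => rw [hT0]; refine (hCn 0).trans ?_; norm_num
    | succ n ih =>
      rw [hTs, pow_succ]
      refine (norm_add_le _ _).trans ?_
      linarith [hYn n, hC1 n]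
  have hY6 : ∀ n, ‖Y n‖ ≤ 6 := fun n => by
    have := pow_pos (one_half_pos (α := ℝ)) n
    linarith [hYn n, hTn n]
  set G : ℕ → Stab A := fun n => star (T n) * T n with hG
  -- `14 = 1 + 6 + 6 + 1`: the transport error, two cross terms, and the Gram element of the new
  -- block.
  have hGG : ∀ n, dist (G n) (G (n + 1)) ≤ 14 * (1 / 2) ^ n := fun n => by
    have e : G (n + 1) - G n = (star (Y n) * Y n - star (T n) * T n) +
        star (Y n) * C (n + 1) + star (C (n + 1)) * Y n + star (C (n + 1)) * C (n + 1) := by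
      simp only [hG, hTs, star_add]; noncomm_ring
    have hq : (1 / 4 : ℝ) ^ n ≤ (1 / 2) ^ n := by gcongr; norm_num
    have h1 : ‖star (Y n) * C (n + 1)‖ ≤ 6 * (1 / 2) ^ n := by
      refine (norm_mul_le _ _).trans ?_
      rw [norm_star]
      gcongr <;> [exact hY6 n; exact hC1 n]
    have h2 : ‖star (C (n + 1)) * Y n‖ ≤ 6 * (1 / 2) ^ n := by
      rwa [← norm_star, star_mul, star_star]
    have h3 : ‖star (C (n + 1)) * C (n + 1)‖ ≤ 1 * (1 / 2) ^ n := by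
      refine (norm_mul_le _ _).trans ?_
      rw [norm_star]
      gcongr <;> [exact (hC1 n).trans (hhalf n); exact hC1 n]
    rw [dist_comm, dist_eq_norm, e]
    refine (norm_add_le _ _).trans ((add_le_add_left (norm_add_le _ _) _).trans ?_)
    have h4 := norm_add_le (star (Y n) * Y n - star (T n) * T n) (star (Y n) * C (n + 1))
    linarith [hYT n, hσ4 n]
  obtain ⟨g, hg⟩ := cauchySeq_tendsto_of_complete
    (cauchySeq_of_le_geometric (1 / 2) 14 (by norm_num) hGG)
  refine ⟨s, g, hg, fun m r => ?_⟩
  -- Block `m` is still empty before stage `m`.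
  have hvan : ∀ n m, n < m → T n * star (col m r) = 0 := fun n => by
    induction n with
    | zero => intro m hm; rw [hT0]; exact col_mul_star_col_of_ne hm.ne _ _
    | succ n ih =>
      intro m hm
      rw [hTs, add_mul, hC, col_mul_star_col_of_ne hm.ne, add_zero, hY, mul_assoc, mul_assoc,
        ih m (by omega), mul_zero, mul_zero]
  have hTm : T m * star (col m r) = d m * d m * star r := by
    cases m with
    | zero => rw [hT0, hC, col_mul_star_col]
    | succ n =>
      rw [hTs, add_mul, hC, col_mul_star_col, hY, mul_assoc, mul_assoc,
        hvan n _ (by omega), mul_zero, mul_zero, zero_add]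
  have hind : ∀ n, m ≤ n →
      ‖col m r * G n * star (col m r) - r * (d m * d m * (d m * d m)) * star r‖ ≤
        ‖r‖ ^ 2 * τ m * (1 - (1 / 2) ^ n) := fun n hmn => by
    induction n, hmn using Nat.le_induction with
    | base =>
      have e : col m r * G m * star (col m r) =
          star (T m * star (col m r)) * (T m * star (col m r)) := by
        simp only [hG, star_mul, star_star, mul_assoc]
      have e2 : col m r * G m * star (col m r) - r * (d m * d m * (d m * d m)) * star r = 0 := by
        rw [e, hTm, star_mul, star_mul, star_star, hsa, sub_eq_zero]
        simp only [mul_assoc]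
      rw [e2, norm_zero]
      have := hτ m
      have := hhalf m
      have : 0 ≤ 1 - (1 / 2 : ℝ) ^ m := by linarith
      positivity
    | succ n hmn ih =>
      -- The block added at stage `n + 1` is orthogonal to block `m`, so only the transport error of
      -- this step changes the `m`-th diagonal entry.
      have e0 : T (n + 1) * star (col m r) = Y n * star (col m r) := by
        rw [hTs, add_mul, hC, col_mul_star_col_of_ne (by omega), add_zero]
      have e1 : col m r * G (n + 1) * star (col m r) =
          col m r * (star (Y n) * Y n) * star (col m r) := by
        have : col m r * G (n + 1) * star (col m r) =
            star (T (n + 1) * star (col m r)) * (T (n + 1) * star (col m r)) := by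
          simp only [hG, star_mul, star_star, mul_assoc]
        rw [this, e0, star_mul, star_star]
        simp only [mul_assoc]
      have e2 : col m r * G (n + 1) * star (col m r) - r * (d m * d m * (d m * d m)) * star r =
          col m r * (star (Y n) * Y n - star (T n) * T n) * star (col m r) +
          (col m r * G n * star (col m r) - r * (d m * d m * (d m * d m)) * star r) := by
        rw [e1]; simp only [hG]; noncomm_ring
      rw [e2]
      have h1 : ‖col m r * (star (Y n) * Y n - star (T n) * T n) * star (col m r)‖ ≤
          ‖r‖ * ((1 / 2) ^ (n + 1) * τ m) * ‖r‖ := by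
        refine (norm_mul_le _ _).trans ?_
        rw [norm_star, norm_col]
        gcongr
        refine (norm_mul_le _ _).trans ?_
        rw [norm_col]
        gcongr
        exact (hYT n).trans (hστ m n hmn)
      refine (norm_add_le _ _).trans ((add_le_add h1 ih).trans (le_of_eq ?_))
      ring
  have hlim : Tendsto (fun n => ‖col m r * G n * star (col m r) -
      r * (d m * d m * (d m * d m)) * star r‖) atTop
      (𝓝 ‖col m r * g * star (col m r) - r * (d m * d m * (d m * d m)) * star r‖) :=
    (((hg.const_mul _).mul_const _).sub_const _).norm
  refine le_of_tendsto hlim (eventually_atTop.2 ⟨m, fun n hmn => (hind n hmn).trans ?_⟩)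
  have := hτ m
  have h1 : 1 - (1 / 2 : ℝ) ^ n ≤ 1 := by linarith [pow_pos (one_half_pos (α := ℝ)) n]
  exact mul_le_of_le_one_right (by positivity) h1

/-- Sequences increasing for Cuntz comparison have a supremum, which is a norm limit of positive
elements below the members of the sequence. -/
theorem exists_sup {b : ℕ → Stab A} (hb : ∀ n, 0 ≤ b n) (hle : ∀ n, CuntzLE (b n) (b (n + 1))) :
    ∃ (G : ℕ → Stab A) (g : Stab A), (∀ n, 0 ≤ G n) ∧ Tendsto G atTop (𝓝 g) ∧
      (∀ n, CuntzLE (G n) (b n)) ∧ ∀ n, CuntzLE (b n) g := by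
  -- Rescaling keeps the Cuntz class and gives the geometric decay under which the Gram elements
  -- converge.
  set κ : ℕ → ℝ := fun n => (1 / 2) ^ n / (1 + ‖b n‖) with hκ
  have hκ0 : ∀ n, 0 < κ n := fun n => by positivity
  set d : ℕ → Stab A := fun n => κ n • b n with hd
  have hd0 : ∀ n, 0 ≤ d n := fun n => smul_nonneg (hκ0 n).le (hb n)
  have hdn : ∀ n, ‖d n‖ ≤ (1 / 2) ^ n := fun n => by
    rw [hd, norm_smul, Real.norm_of_nonneg (hκ0 n).le, hκ, div_mul_eq_mul_div,
      div_le_iff₀ (by positivity)]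
    gcongr
    linarith
  have hdb : ∀ n, CuntzLE (d n) (b n) := fun n => CuntzLE.smul (hκ0 n).le _
  have hbd : ∀ n, CuntzLE (b n) (d n) := fun n => CuntzLE.of_smul (hκ0 n) _
  have hle' : ∀ m n, m ≤ n → CuntzLE (b m) (b n) := fun m n hmn => by
    induction n, hmn using Nat.le_induction with
    | base => exact CuntzLE.refl _
    | succ n _ ih => exact ih.trans (hle n)
  have hq0 : ∀ n, 0 ≤ d n * d n := fun n => by
    simpa [(IsSelfAdjoint.of_nonneg (hd0 n)).star_eq] using star_mul_self_nonneg (d n)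
  have h4b : ∀ n, CuntzLE (d n * d n * (d n * d n)) (b n) := fun n =>
    ((CuntzLE.mul_self_le (hq0 n)).trans (CuntzLE.mul_self_le (hd0 n))).trans (hdb n)
  have hb4 : ∀ n, CuntzLE (b n) (d n * d n * (d n * d n)) := fun n =>
    ((hbd n).trans (CuntzLE.le_mul_self (hd0 n))).trans (CuntzLE.le_mul_self (hq0 n))
  -- These witnesses are fixed before the limit is built, so that the tolerance `τ m` can be divided
  -- by the norms of the finitely many `r n m` with `n ≤ m`. For `n > m` the value is a dummy.
  have hr : ∀ n m : ℕ, ∃ r : Stab A, n ≤ m →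
      ‖r * (d m * d m * (d m * d m)) * star r - d n * d n * (d n * d n)‖ < 1 / ((m : ℝ) + 1) := by
    intro n m
    by_cases hnm : n ≤ m
    · obtain ⟨r, hr⟩ := ((h4b n).trans ((hle' n m hnm).trans (hb4 m))) (1 / ((m : ℝ) + 1))
        (by positivity)
      exact ⟨r, fun _ => hr⟩
    · exact ⟨0, fun h => (hnm h).elim⟩
  choose r hr using hr
  set S : ℕ → ℝ := fun m => 1 + ∑ n ∈ Finset.range (m + 1), ‖r n m‖ ^ 2 with hS
  have hS0 : ∀ m, 0 < S m := fun m => by positivity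
  obtain ⟨s, g, hg, h⟩ := exists_gram_limit hd0 hdn (fun n =>
    (CuntzLE.mul_self_le (hd0 n)).trans ((hdb n).trans ((hle n).trans ((hbd (n + 1)).trans
      (CuntzLE.le_mul_self (hd0 (n + 1)))))))
    (τ := fun m => 1 / ((m : ℝ) + 1) / S m) (fun m => by have := hS0 m; positivity)
  refine ⟨_, g, fun n => star_mul_self_nonneg _, hg, fun n => ?_, fun n => ?_⟩
  · refine CuntzLE.trans ?_ ((CuntzLE.mul_self_le (hd0 n)).trans (hdb n))
    convert CuntzLE.conj (star (s n)) (d n * d n) using 1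
    rw [star_mul, star_star, (IsSelfAdjoint.of_nonneg (hd0 n)).star_eq]
    simp only [mul_assoc]
  · refine (hb4 n).trans (CuntzLE.of_approx fun ε hε => ?_)
    -- Half of `ε` pays for replacing block `M` of `g` by `d M ^ 4`, the other half for replacing
    -- that by `d n ^ 4`.
    obtain ⟨m, hm⟩ := exists_nat_one_div_lt (half_pos hε)
    set M := max m n
    have hM : 1 / ((M : ℝ) + 1) < ε / 2 := by
      refine lt_of_le_of_lt ?_ hm
      gcongr
      exact le_max_left _ _
    refine ⟨_, ?_, CuntzLE.conj (col M (r n M)) g⟩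
    have h1 := h M (r n M)
    have h2 := hr n M (le_max_right _ _)
    have h3 : ‖r n M‖ ^ 2 ≤ S M := by
      have := Finset.single_le_sum (f := fun n => ‖r n M‖ ^ 2) (fun i _ => by positivity)
        (Finset.mem_range.2 (Nat.lt_succ_of_le (le_max_right m n)))
      simp only [hS]
      linarith
    have h4 : ‖r n M‖ ^ 2 * (1 / ((M : ℝ) + 1) / S M) ≤ 1 / ((M : ℝ) + 1) := by
      rw [mul_div_assoc', div_le_iff₀ (hS0 M), mul_comm]
      gcongr
    have h5 := norm_sub_le_norm_sub_add_norm_sub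
      (col M (r n M) * g * star (col M (r n M)))
      (r n M * (d M * d M * (d M * d M)) * star (r n M)) (d n * d n * (d n * d n))
    linarith

end Cuntz

end CuntzProof

noncomputable section CuntzProof

namespace Cuntz

open Filter Topology

/-! ### Compact containment in an ordered set -/

section CompactContainment

variable {S : Type*} [PartialOrder S]

theorem CompactlyContained.mono {s s' t t' : S} (h : CompactlyContained s' t') (hs : s ≤ s')
    (ht : t' ≤ t) : CompactlyContained s t := fun v u hv hu htu =>
  let ⟨n, hn⟩ := h v u hv hu (ht.trans htu)
  ⟨n, hs.trans hn⟩

theorem CompactlyContained.le {s t : S} (h : CompactlyContained s t) : s ≤ t := by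
  obtain ⟨-, hn⟩ := h (fun _ => t) t monotone_const (by simp) le_rfl
  exact hn

end CompactContainment

variable {A : Type*} [NonUnitalCStarAlgebra A] [PartialOrder A] [StarOrderedRing A]

/-! ### Orthogonal sums -/

namespace Stab

theorem move_mono (f : ℕ ↪ ℕ) {a b : Stab A} (h : a ≤ b) : move f f a ≤ move f f b := by
  rw [← sub_nonneg, ← map_sub]
  exact move_nonneg f (sub_nonneg.2 h)

/-- The underlying operation of `PosStab.oplus`. -/
def dsum (a b : Stab A) : Stab A := move evenEmb evenEmb a + move oddEmb oddEmb b

theorem dsum_mul (a b c d : Stab A) : dsum a b * dsum c d = dsum (a * c) (b * d) := by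
  simp only [dsum, add_mul, mul_add, move_mul_move,
    move_mul_move_of_disjoint _ _ disjoint_even_odd,
    move_mul_move_of_disjoint _ _ disjoint_even_odd.symm, zero_add, add_zero]

theorem star_dsum (a b : Stab A) : star (dsum a b) = dsum (star a) (star b) := by
  simp only [dsum, star_add, star_move]

theorem smul_dsum (c : ℝ) (a b : Stab A) : c • dsum a b = dsum (c • a) (c • b) := by
  simp only [dsum, smul_add, ContinuousLinearMap.map_smul_of_tower]

theorem dsum_sub (a b c d : Stab A) : dsum a b - dsum c d = dsum (a - c) (b - d) := by
  simp only [dsum, map_sub]; abel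

theorem dsum_mono {a b c d : Stab A} (h : a ≤ b) (h' : c ≤ d) : dsum a c ≤ dsum b d :=
  add_le_add (move_mono _ h) (move_mono _ h')

theorem norm_dsum_le (a b : Stab A) : ‖dsum a b‖ ≤ ‖a‖ + ‖b‖ :=
  (norm_add_le _ _).trans (by rw [norm_move, norm_move])

end Stab

open Stab

theorem CuntzLE.move_le (f : ℕ ↪ ℕ) (a : Stab A) : CuntzLE (Stab.move f f a) a := by
  simpa [Stab.move_refl] using CuntzLE.sum_move (fun _ : Unit => f)
    (fun _ : Unit => Function.Embedding.refl ℕ) (fun i j hij => (hij rfl).elim)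
    (fun _ => CuntzLE.refl a)

/-- Conjugating `a ⊕ b` by the row `(x, y)` gives `x a x* + y b y*`, where `x` and `y` act as
approximate units. -/
theorem CuntzLE.add_le_dsum (a b : Stab A) : CuntzLE (a + b) (dsum a b) := by
  intro ε hε
  obtain ⟨x, hx⟩ := CuntzLE.refl a (ε / 2) (half_pos hε)
  obtain ⟨y, hy⟩ := CuntzLE.refl b (ε / 2) (half_pos hε)
  refine ⟨Stab.move (.refl ℕ) evenEmb x + Stab.move (.refl ℕ) oddEmb y, ?_⟩
  have e : (Stab.move (.refl ℕ) evenEmb x + Stab.move (.refl ℕ) oddEmb y) * dsum a b *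
      star (Stab.move (.refl ℕ) evenEmb x + Stab.move (.refl ℕ) oddEmb y) - (a + b) =
      (x * a * star x - a) + (y * b * star y - b) := by
    simp only [dsum, star_add, Stab.star_move, add_mul, mul_add, Stab.move_mul_move,
      Stab.move_mul_move_of_disjoint _ _ disjoint_even_odd,
      Stab.move_mul_move_of_disjoint _ _ disjoint_even_odd.symm, zero_add, add_zero,
      Stab.move_refl]
    abel
  rw [e]
  exact (norm_add_le _ _).trans_lt (by linarith)

/-- Conjugating `a + b` by the column with entries `a`, `b` gives `a³ ⊕ b³`: orthogonality kills the
off-diagonal entries `a (a + b) b`. -/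
theorem CuntzLE.dsum_le_add {a b : Stab A} (ha : 0 ≤ a) (hb : 0 ≤ b) (hab : a * b = 0) :
    CuntzLE (dsum a b) (a + b) := by
  have hsa := (IsSelfAdjoint.of_nonneg ha).star_eq
  have hsb := (IsSelfAdjoint.of_nonneg hb).star_eq
  have hba : b * a = 0 := by rw [← star_eq_zero, star_mul, hsa, hsb, hab]
  refine (CuntzLE.move₂ disjoint_even_odd (CuntzLE.le_cube ha) (CuntzLE.le_cube hb)).trans ?_
  convert CuntzLE.conj (Stab.move evenEmb (.refl ℕ) a + Stab.move oddEmb (.refl ℕ) b) (a + b)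
    using 1
  have e : a + b = Stab.move (.refl ℕ) (.refl ℕ) (a + b) := (Stab.move_refl _).symm
  rw [e, star_add, Stab.star_move, Stab.star_move, hsa, hsb]
  simp only [add_mul, mul_add, map_add, Stab.move_mul_move, mul_assoc, hab, hba, mul_zero,
    map_zero, add_zero, zero_add]

/-! ### Suprema and compact containment in the Cuntz semigroup -/

namespace Cu

theorem mk_le_mk' {a b : PosStab A} : mk a ≤ mk b ↔ CuntzLE a.val b.val := mk_le_mk

/-- The cut-down `(a - ε)₊` as a positive element. -/
def cutPos (ε : ℝ) (a : PosStab A) : PosStab A := ⟨cut ε a.val, cut_nonneg ε a.val⟩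

theorem add_le_add_of_le {s t s' t' : Cu A} (h : s ≤ t) (h' : s' ≤ t') : s + s' ≤ t + t' := by
  obtain ⟨a, rfl⟩ := mk_surjective s
  obtain ⟨b, rfl⟩ := mk_surjective t
  obtain ⟨c, rfl⟩ := mk_surjective s'
  obtain ⟨d, rfl⟩ := mk_surjective t'
  exact mk_le_mk.2 (PosStab.oplus_le_oplus (mk_le_mk.1 h) (mk_le_mk.1 h'))

/-- The approximants `G n` are recorded with the supremum because compact containment is tested
against them. An upper bound dominates every `G n`, hence also their norm limit. -/
theorem exists_isLUB {v : ℕ → Cu A} (hv : Monotone v) :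
    ∃ (G : ℕ → PosStab A) (g : PosStab A), Tendsto (fun n => (G n).val) atTop (𝓝 g.val) ∧
      (∀ n, mk (G n) ≤ v n) ∧ IsLUB (Set.range v) (mk g) := by
  choose b hb using fun n => mk_surjective (v n)
  obtain ⟨G, g, hG, hg, h1, h2⟩ := exists_sup (b := fun n => (b n).val) (fun n => (b n).nonneg)
    (fun n => mk_le_mk'.1 (by rw [hb, hb]; exact hv (Nat.le_succ n)))
  have hg0 : 0 ≤ g := ge_of_tendsto' hg hG
  refine ⟨fun n => ⟨G n, hG n⟩, ⟨g, hg0⟩, hg, fun n => ?_, ?_, fun u hu => ?_⟩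
  · rw [← hb]; exact h1 n
  · rintro _ ⟨n, rfl⟩
    rw [← hb]; exact h2 n
  · obtain ⟨c, rfl⟩ := mk_surjective u
    refine mk_le_mk'.2 (CuntzLE.of_approx fun ε hε => ?_)
    obtain ⟨n, hn⟩ := (hg.eventually (Metric.ball_mem_nhds g hε)).exists
    refine ⟨G n, by simpa [dist_eq_norm] using hn, (h1 n).trans ?_⟩
    exact mk_le_mk'.1 (by rw [hb]; exact hu ⟨n, rfl⟩)

/-- The hypothesis leaves room for perturbing `a` by `δ`, and a conjugate of some approximant of the
supremum is within `δ` of `a`. A general `e` is allowed so that direct sums of cut-downs qualify. -/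
theorem compactlyContained_of_le {x a : PosStab A} {e : Stab A} {c δ : ℝ} (hc : 0 < c)
    (hδ : 0 < δ) (h : c • x.val ≤ e * a.val * star e - δ • (e * star e)) :
    CompactlyContained (mk x) (mk a) := by
  intro v u hv hu hau
  obtain ⟨G, g, hg, hGv, hlub⟩ := exists_isLUB hv
  rw [hu.unique hlub, mk_le_mk'] at hau
  obtain ⟨r, hr⟩ := hau (δ / 2) (half_pos hδ)
  have hlim : Tendsto (fun n => ‖r * (G n).val * star r - a.val‖) atTop
      (𝓝 ‖r * g.val * star r - a.val‖) :=
    (((hg.const_mul r).mul_const (star r)).sub_const _).norm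
  obtain ⟨n, hn⟩ := (hlim.eventually (gt_mem_nhds (hr.trans (half_lt_self hδ)))).exists
  refine ⟨n, le_trans (mk_le_mk'.2 ?_) (hGv n)⟩
  have h1 : CuntzLE (c • x.val) (r * (G n).val * star r) :=
    CuntzLE.of_norm_sub_le (.of_nonneg a.nonneg)
      (.of_nonneg (star_right_conjugate_nonneg (G n).nonneg r)) (smul_nonneg hc.le x.nonneg)
      (by rw [norm_sub_rev]; exact hn.le) h
  exact (CuntzLE.of_smul hc _).trans (h1.trans (CuntzLE.conj _ _))

theorem cutPos_compactlyContained (a : PosStab A) {ε : ℝ} (hε : 0 < ε) :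
    CompactlyContained (mk (cutPos ε a)) (mk a) :=
  compactlyContained_of_le (pow_pos (sub_pos.2 (half_lt_self hε)) 2) (half_pos hε)
    (smul_cut_le a.nonneg (half_pos hε).le (half_lt_self hε).le)

theorem cutPos_cutPos (a : PosStab A) {ε δ : ℝ} (hδ : 0 ≤ δ) (h : δ < ε) :
    cutPos ε a = cutPos (ε - δ) (cutPos δ a) := by
  have := cut_cut a.nonneg (sub_pos.2 h).le hδ
  rw [add_sub_cancel] at this
  simp only [cutPos, this]

theorem cutPos_compactlyContained_cutPos (a : PosStab A) {ε δ : ℝ} (hδ : 0 ≤ δ) (h : δ < ε) :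
    CompactlyContained (mk (cutPos ε a)) (mk (cutPos δ a)) := by
  rw [cutPos_cutPos a hδ h]
  exact cutPos_compactlyContained _ (sub_pos.2 h)

theorem cutPos_le_cutPos (a : PosStab A) {ε δ : ℝ} (hδ : 0 ≤ δ) (h : δ ≤ ε) :
    mk (cutPos ε a) ≤ mk (cutPos δ a) :=
  mk_le_mk'.2 (CuntzLE.of_le (cut_nonneg _ _) (cut_le_cut a.nonneg hδ h))

theorem cutPos_le (a : PosStab A) {ε : ℝ} (hε : 0 ≤ ε) : mk (cutPos ε a) ≤ mk a :=
  mk_le_mk'.2 (CuntzLE.of_le (cut_nonneg _ _) (cut_le a.nonneg hε))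

/-- The canonical rapidly increasing sequence with supremum `[a]`. -/
def cutSeq (a : PosStab A) (n : ℕ) : Cu A := mk (cutPos (1 / ((n : ℝ) + 1)) a)

theorem rapidlyIncreasing_cutSeq (a : PosStab A) : RapidlyIncreasing (cutSeq a) := fun n => by
  refine cutPos_compactlyContained_cutPos a (by positivity) ?_
  push_cast
  gcongr
  linarith

theorem monotone_cutSeq (a : PosStab A) : Monotone (cutSeq a) :=
  monotone_nat_of_le_succ fun n => (rapidlyIncreasing_cutSeq a n).le

theorem isLUB_cutSeq (a : PosStab A) : IsLUB (Set.range (cutSeq a)) (mk a) := by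
  refine ⟨?_, fun u hu => ?_⟩
  · rintro _ ⟨n, rfl⟩
    exact cutPos_le a (by positivity)
  · obtain ⟨c, rfl⟩ := mk_surjective u
    refine mk_le_mk'.2 (CuntzLE.of_cut a.nonneg fun ε hε => ?_)
    obtain ⟨n, hn⟩ := exists_nat_one_div_lt hε
    exact mk_le_mk'.1 ((cutPos_le_cutPos a (by positivity) hn.le).trans (hu ⟨n, rfl⟩))

theorem exists_le_cutPos {s : Cu A} {a : PosStab A} (h : CompactlyContained s (mk a)) :
    ∃ ε > 0, s ≤ mk (cutPos ε a) := by
  obtain ⟨n, hn⟩ := h _ _ (monotone_cutSeq a) (isLUB_cutSeq a) le_rfl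
  exact ⟨_, by positivity, hn⟩

/-! ### The order axioms -/

theorem isPositivelyOrdered : IsPositivelyOrdered (Cu A) where
  add_le_add_right _ _ h _ := add_le_add_of_le h le_rfl
  zero_le s := by
    obtain ⟨a, rfl⟩ := mk_surjective s
    exact mk_le_mk'.2 (CuntzLE.zero _)

theorem axiomO1 : AxiomO1 (Cu A) := fun _ hv =>
  let ⟨_, g, _, _, h⟩ := exists_isLUB hv
  ⟨mk g, h⟩

theorem axiomO2 : AxiomO2 (Cu A) := fun s => by
  obtain ⟨a, rfl⟩ := mk_surjective s
  exact ⟨cutSeq a, rapidlyIncreasing_cutSeq a, isLUB_cutSeq a⟩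

theorem axiomO3 : AxiomO3 (Cu A) := by
  intro s₁ s₂ t₁ t₂ h₁ h₂
  obtain ⟨a, rfl⟩ := mk_surjective t₁
  obtain ⟨b, rfl⟩ := mk_surjective t₂
  obtain ⟨ε₁, hε₁, h₁⟩ := exists_le_cutPos h₁
  obtain ⟨ε₂, hε₂, h₂⟩ := exists_le_cutPos h₂
  -- A common `ε` gives both blocks the same constants `c` and `δ`, so the two inequalities add up
  -- to one for the direct sum.
  set ε := min ε₁ ε₂
  have hε : 0 < ε := lt_min hε₁ hε₂
  have h₁' := h₁.trans (cutPos_le_cutPos a hε.le (min_le_left _ _))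
  have h₂' := h₂.trans (cutPos_le_cutPos b hε.le (min_le_right _ _))
  refine CompactlyContained.mono ?_ (add_le_add_of_le h₁' h₂') le_rfl
  rw [mk_add_mk, mk_add_mk]
  refine compactlyContained_of_le (e := dsum (cut (ε / 2) a.val) (cut (ε / 2) b.val))
    (pow_pos (sub_pos.2 (half_lt_self hε)) 2) (half_pos hε) ?_
  change _ • dsum (cut ε a.val) (cut ε b.val) ≤ _ * dsum a.val b.val * _ - _
  rw [star_dsum, dsum_mul, dsum_mul, dsum_mul, smul_dsum, smul_dsum, dsum_sub]
  exact dsum_mono (smul_cut_le a.nonneg (half_pos hε).le (half_lt_self hε).le)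
    (smul_cut_le b.nonneg (half_pos hε).le (half_lt_self hε).le)

theorem axiomO4 : AxiomO4 (Cu A) := by
  intro v w s t hv hw hs ht
  refine ⟨?_, fun u hu => ?_⟩
  · rintro _ ⟨n, rfl⟩
    exact add_le_add_of_le (hs.1 ⟨n, rfl⟩) (ht.1 ⟨n, rfl⟩)
  · obtain ⟨a, rfl⟩ := mk_surjective s
    obtain ⟨b, rfl⟩ := mk_surjective t
    obtain ⟨c, rfl⟩ := mk_surjective u
    rw [mk_add_mk]
    refine mk_le_mk'.2 (CuntzLE.of_approx fun ε hε => ?_)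
    have hε3 : 0 < ε / 3 := by positivity
    -- Each cut-down is reached at a finite stage, and the sum of the cut-downs is within `2 ε / 3`
    -- of the representative of `s + t`.
    obtain ⟨n, hn⟩ := cutPos_compactlyContained a hε3 v _ hv hs le_rfl
    obtain ⟨m, hm⟩ := cutPos_compactlyContained b hε3 w _ hw ht le_rfl
    refine ⟨dsum (cut (ε / 3) a.val) (cut (ε / 3) b.val), ?_, ?_⟩
    · change ‖_ - dsum a.val b.val‖ < ε
      rw [dsum_sub]
      refine (norm_dsum_le _ _).trans_lt ?_
      linarith [norm_cut_sub_le a.nonneg hε3.le, norm_cut_sub_le b.nonneg hε3.le]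
    · have h := (add_le_add_of_le (hn.trans (hv (le_max_left n m)))
        (hm.trans (hw (le_max_right n m)))).trans (hu ⟨max n m, rfl⟩)
      exact mk_le_mk'.1 h

/-- The complement exists for an element of `d B d` with `d² = b`. So `a` is replaced by `a' = x* x`
with `x = k r d`, whose class lies between `[(a - ε/2)₊]` and `[a]`; that is close enough, as `s'`
is already below `[(a - ε)₊]`. -/
theorem axiomO5 : AxiomO5 (Cu A) := by
  intro s' s t hs hst
  obtain ⟨a, rfl⟩ := mk_surjective s
  obtain ⟨b, rfl⟩ := mk_surjective t
  obtain ⟨ε, hε, hs⟩ := exists_le_cutPos hs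
  obtain ⟨d, hd, hdd⟩ : ∃ d : Stab A, IsSelfAdjoint d ∧ d * d = b.val :=
    ⟨CFC.sqrt b.val, .of_nonneg (CFC.sqrt_nonneg _), CFC.sqrt_mul_sqrt_self _ b.nonneg⟩
  obtain ⟨r, hr⟩ := mk_le_mk'.1 hst (ε / 4) (by positivity)
  have hrb : 0 ≤ r * b.val * star r := star_right_conjugate_nonneg b.nonneg r
  set k := cut (ε / 4) a.val with hk
  have hksa : star k = k := (cut_isSelfAdjoint _ _).star_eq
  set x := k * r * d with hx
  have hxx : x * star x = k * (r * b.val * star r) * k := by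
    simp only [hx, star_mul, hd.star_eq, hksa, ← hdd, mul_assoc]
  let a' : PosStab A := ⟨star x * x, star_mul_self_nonneg x⟩
  have ha' : a'.val = d * (star r * k * k * r) * d := by
    simp only [a', hx, star_mul, hd.star_eq, hksa, mul_assoc]
  have h1 : mk (cutPos (ε / 2) a) ≤ mk a' := by
    refine mk_le_mk'.2 (CuntzLE.trans ?_ (CuntzLE.mul_star_le x))
    rw [hxx]
    exact CuntzLE.cut_of_conj a.nonneg (.of_nonneg hrb) (by positivity) (by linarith)
      (by rw [norm_sub_rev]; exact hr.le)
  have h2 : CuntzLE a'.val a.val := by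
    refine (CuntzLE.star_mul_le x).trans ?_
    rw [hxx]
    exact CuntzLE.cut_conj_le a.nonneg hrb (by positivity)
  -- From `s' ≤ [(a - ε)₊] ≪ [(a - ε/2)₊] ≤ [a']` one gets `s' ≪ [a']`, so a cut-down of `a'` itself
  -- still dominates `s'`.
  obtain ⟨η, hη, h3⟩ := exists_le_cutPos
    ((cutPos_compactlyContained_cutPos a (half_pos hε).le (half_lt_self hε)).mono hs h1)
  obtain ⟨c, g, hc, hg, h4, h5, h6, h7⟩ := exists_complement hd a'.nonneg ha' hη
  rw [hdd] at h5 h6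
  refine ⟨mk ⟨c, hc⟩, ?_, ?_⟩
  · refine (add_le_add_of_le h3 le_rfl).trans ?_
    rw [mk_add_mk]
    exact mk_le_mk'.2 ((CuntzLE.dsum_le_add (cut_nonneg _ _) hc h4).trans h5)
  · rw [mk_add_mk]
    refine mk_le_mk'.2 (h6.trans ?_)
    rw [add_comm]
    exact (CuntzLE.add_le_dsum g c).trans
      (CuntzLE.move₂ disjoint_even_odd (h7.trans h2) (CuntzLE.refl c))

/-- Compressing `x (b ⊕ c) x*` by `k = (a - ε/2)₊` gives a sum of two positive elements that
dominates `(a - ε)₊`. Each summand is below `a` because of `k`, and below `b` or `c` because it is a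
conjugate of it. -/
theorem axiomO6 : AxiomO6 (Cu A) := by
  intro s r t hs s' hs'
  obtain ⟨a, rfl⟩ := mk_surjective s
  obtain ⟨b, rfl⟩ := mk_surjective r
  obtain ⟨c, rfl⟩ := mk_surjective t
  obtain ⟨ε, hε, hs'⟩ := exists_le_cutPos hs'
  rw [mk_add_mk, mk_le_mk'] at hs
  obtain ⟨x, hx⟩ := hs (ε / 2) (half_pos hε)
  set k := cut (ε / 2) a.val with hk
  have hk0 : IsSelfAdjoint k := cut_isSelfAdjoint _ _
  have key : ∀ (f : ℕ ↪ ℕ) (b : PosStab A), 0 ≤ x * Stab.move f f b.val * star x ∧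
      CuntzLE (k * (x * Stab.move f f b.val * star x) * k) b.val := fun f b => by
    refine ⟨star_right_conjugate_nonneg (move_nonneg f b.nonneg) x, ?_⟩
    have := CuntzLE.conj k (x * Stab.move f f b.val * star x)
    rw [hk0.star_eq] at this
    exact this.trans ((CuntzLE.conj _ _).trans (CuntzLE.move_le f _))
  obtain ⟨hb, hb'⟩ := key evenEmb b
  obtain ⟨hc, hc'⟩ := key oddEmb c
  refine ⟨mk ⟨_, hk0.conjugate_nonneg hb⟩, mk ⟨_, hk0.conjugate_nonneg hc⟩, ?_, mk_le_mk'.2 hb',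
    mk_le_mk'.2 (CuntzLE.cut_conj_le a.nonneg hb (half_pos hε).le), mk_le_mk'.2 hc',
    mk_le_mk'.2 (CuntzLE.cut_conj_le a.nonneg hc (half_pos hε).le)⟩
  refine hs'.trans (mk_le_mk'.2 (CuntzLE.trans ?_ (CuntzLE.add_le_dsum _ _)))
  have h := CuntzLE.cut_of_conj a.nonneg
    (.of_nonneg (star_right_conjugate_nonneg (b.oplus c).nonneg x)) (half_pos hε).le
    (half_lt_self hε) (by rw [norm_sub_rev]; exact hx.le)
  have e : k * (x * (b.oplus c).val * star x) * k =
      k * (x * Stab.move evenEmb evenEmb b.val * star x) * k +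
        k * (x * Stab.move oddEmb oddEmb c.val * star x) * k := by
    rw [PosStab.oplus_val]
    noncomm_ring
  rwa [← hk, e] at h

end Cu

end Cuntz

end CuntzProof

noncomputable section CuntzProof

namespace Cuntz

open Filter Topology

variable {A : Type*} [NonUnitalCStarAlgebra A]

/-! ### Countable density for separable algebras -/

namespace FinMat

/-- The matrix with upper left corner `x` and zeros elsewhere. -/
def ofCorner (n : ℕ) : CStarMatrix (Fin n) (Fin n) A →ₗ[ℂ] FinMat A where
  toFun x := ⟨spread Fin.valEmbedding Fin.valEmbedding x, n, fun i j h => by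
    rcases h with h | h
    · exact spread_of_left _ _ _ (by rintro ⟨p, rfl⟩; exact absurd p.2 (not_lt.2 h)) _
    · exact spread_of_right _ _ _ _ (by rintro ⟨p, rfl⟩; exact absurd p.2 (not_lt.2 h))⟩
  map_add' x y := Subtype.ext (spread_add _ _ x y)
  map_smul' c x := Subtype.ext (spread_smul _ _ c x)

theorem below_ofCorner (n : ℕ) (x : CStarMatrix (Fin n) (Fin n) A) : Below n (ofCorner n x) :=
  fun i j h => by
    rcases h with h | h
    · exact spread_of_left _ _ _ (by rintro ⟨p, rfl⟩; exact absurd p.2 (not_lt.2 h)) _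
    · exact spread_of_right _ _ _ _ (by rintro ⟨p, rfl⟩; exact absurd p.2 (not_lt.2 h))

theorem corner_ofCorner (n : ℕ) (x : CStarMatrix (Fin n) (Fin n) A) :
    corner n (ofCorner n x) = x := by
  ext i j
  exact spread_apply Fin.valEmbedding Fin.valEmbedding x i j

theorem exists_eq_ofCorner (x : FinMat A) : ∃ n, ofCorner n (corner n x) = x := by
  obtain ⟨n, hn⟩ := exists_below x
  exact ⟨n, eq_of_corner (below_ofCorner _ _) hn (corner_ofCorner _ _)⟩

variable [PartialOrder A] [StarOrderedRing A]

theorem norm_ofCorner (n : ℕ) (x : CStarMatrix (Fin n) (Fin n) A) : ‖ofCorner n x‖ = ‖x‖ := by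
  rw [norm_eq (below_ofCorner n x), corner_ofCorner]

end FinMat

variable [PartialOrder A] [StarOrderedRing A]

theorem Stab.separableSpace [TopologicalSpace.SeparableSpace A] :
    TopologicalSpace.SeparableSpace (Stab A) := by
  have hcont : ∀ n, Continuous fun x : Fin n → Fin n → A =>
      (incl (FinMat.ofCorner n (CStarMatrix.ofMatrix x)) : Stab A) := fun n => by
    refine incl.continuous.comp (Continuous.comp ?_ ?_)
    · exact (AddMonoidHomClass.isometry_of_norm (FinMat.ofCorner n)
        (FinMat.norm_ofCorner n)).continuous
    · exact continuous_id
  have hs : TopologicalSpace.IsSeparable (⋃ n, Set.range fun x : Fin n → Fin n → A =>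
      (incl (FinMat.ofCorner n (CStarMatrix.ofMatrix x)) : Stab A)) :=
    .iUnion fun n => TopologicalSpace.isSeparable_range (hcont n)
  refine TopologicalSpace.isSeparable_univ_iff.1 (hs.closure.mono fun x _ => ?_)
  refine closure_mono ?_ (denseRange_incl x)
  rintro _ ⟨y, rfl⟩
  obtain ⟨n, hn⟩ := FinMat.exists_eq_ofCorner y
  exact Set.mem_iUnion.2 ⟨n, FinMat.corner n y, congrArg incl hn⟩

namespace Cu

/-- A set that interpolates compact containment is dense. -/
theorem isDenseSubset_of_interpolate {D : Set (Cu A)}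
    (hD : ∀ s t : Cu A, CompactlyContained s t → ∃ d ∈ D, s ≤ d ∧ d ≤ t) : IsDenseSubset D := by
  intro s
  obtain ⟨a, rfl⟩ := mk_surjective s
  choose d hdD hd hd' using fun n => hD _ _ (rapidlyIncreasing_cutSeq a n)
  -- Only every second interpolant is kept: `d (2n) ≤ cutSeq a (2n+1) ≪ cutSeq a (2n+2) ≤ d (2n+2)`,
  -- whereas consecutive ones need not satisfy `≪`.
  refine ⟨fun n => d (2 * n), fun n => hdD _, fun n => ?_, ?_, fun u hu => ?_⟩
  · exact (rapidlyIncreasing_cutSeq a (2 * n + 1)).mono (hd' _) (hd (2 * n + 2))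
  · rintro _ ⟨n, rfl⟩
    exact (hd' _).trans ((isLUB_cutSeq a).1 ⟨_, rfl⟩)
  · refine (isLUB_cutSeq a).2 ?_
    rintro _ ⟨n, rfl⟩
    exact (monotone_cutSeq a (by omega : n ≤ 2 * n)).trans ((hd _).trans (hu ⟨n, rfl⟩))

theorem exists_countable_dense [TopologicalSpace.SeparableSpace A] :
    ∃ D : Set (Cu A), D.Countable ∧ IsDenseSubset D := by
  have := Stab.separableSpace (A := A)
  have : SecondCountableTopology (Stab A) := UniformSpace.secondCountable_of_separable _
  obtain ⟨E, hE, hEd⟩ := TopologicalSpace.exists_countable_dense {x : Stab A // 0 ≤ x}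
  let F : {x : Stab A // 0 ≤ x} × ℕ → Cu A := fun p => cutSeq ⟨p.1.1, p.1.2⟩ p.2
  refine ⟨F '' (E ×ˢ Set.univ), (hE.prod Set.countable_univ).image F,
    isDenseSubset_of_interpolate fun s t hst => ?_⟩
  obtain ⟨a, rfl⟩ := mk_surjective t
  obtain ⟨ε, hε, hs⟩ := exists_le_cutPos hst
  obtain ⟨n, hn⟩ := exists_nat_one_div_lt (by positivity : 0 < ε / 4)
  have hn0 : 0 < 1 / ((n : ℝ) + 1) := by positivity
  set δ : ℝ := 1 / ((n : ℝ) + 1) with hδ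
  -- As `‖a - b‖ < δ/2`, the cut-down `(b - δ)₊` is below `a`. It is within `3 δ / 2 < ε / 2` of
  -- `a`, so it lies above `(a - ε)₊`.
  obtain ⟨b, hbE, hb⟩ := hEd.exists_dist_lt ⟨a.val, a.nonneg⟩ (half_pos hn0)
  have hb' : ‖a.val - b.1‖ < δ / 2 := by rwa [Subtype.dist_eq, dist_eq_norm] at hb
  refine ⟨F (b, n), ⟨(b, n), ⟨hbE, trivial⟩, rfl⟩, hs.trans ?_, ?_⟩
  · refine mk_le_mk'.2 (CuntzLE.cut_of_norm_sub_le (δ := ε / 2) a.nonneg (cut_isSelfAdjoint _ _)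
      (by positivity) (by linarith) ?_)
    have h1 := norm_cut_sub_le b.2 hn0.le
    have h2 := norm_sub_le_norm_sub_add_norm_sub a.val b.1 (cut δ b.1)
    rw [norm_sub_rev] at h1
    linarith
  · exact mk_le_mk'.2 (CuntzLE.cut_of_norm_sub_le (δ := δ / 2) b.2 (.of_nonneg a.nonneg)
      (by positivity) (half_lt_self hn0) (by rw [norm_sub_rev]; exact hb'.le))

end Cu

end Cuntz

end CuntzProof

theorem proposition4p1 (A : Type*) [NonUnitalCStarAlgebra A] [PartialOrder A] [StarOrderedRing A] :
    (Cuntz.IsPositivelyOrdered (Cuntz.Cu A) ∧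
      Cuntz.AxiomO1 (Cuntz.Cu A) ∧ Cuntz.AxiomO2 (Cuntz.Cu A) ∧ Cuntz.AxiomO3 (Cuntz.Cu A) ∧
      Cuntz.AxiomO4 (Cuntz.Cu A) ∧ Cuntz.AxiomO5 (Cuntz.Cu A) ∧ Cuntz.AxiomO6 (Cuntz.Cu A)) ∧
    (TopologicalSpace.SeparableSpace A →
      ∃ D : Set (Cuntz.Cu A), D.Countable ∧ Cuntz.IsDenseSubset D) :=
  ⟨⟨Cuntz.Cu.isPositivelyOrdered, Cuntz.Cu.axiomO1, Cuntz.Cu.axiomO2, Cuntz.Cu.axiomO3,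
    Cuntz.Cu.axiomO4, Cuntz.Cu.axiomO5, Cuntz.Cu.axiomO6⟩,
    fun _ => Cuntz.Cu.exists_countable_dense⟩
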